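/- Let $G\subset \mathrm{GL}(3,\mathbb C)$ be a finite cyclic group, in coordinates in which $G$ is diagonal. Put $$N=\{v\in\mathbb R^3 : \operatorname{diag}(e^{2\pi i v_1},e^{2\pi i v_2},e^{2\pi i v_3})\in G\},\qquad \sigma=\mathbb R^3_{\ge 0},$$ so that $N=\mathbb Z^3+\mathbb Z\,\tfrac1r(a_1,a_2,a_3)$ if $G$ is of type $\tfrac1r(a_1,a_2,a_3)$, and $\mathbb C^3/G$ is the affine toric variety of $(N,\sigma)$. Suppose that $G$ contains no quasi-reflections and that $\mathbb C^3/G$ has canonical singularities; that is (Reid–Tai), $v_1+v_2+v_3\ge 1$ for every nonzero $v\in N\cap\sigma$. Then $\mathbb C^3/G$ has an iterated Fujiki–Oka resolution that is a Hilbert desingularization: there is a fan $\Delta$ that is both of the following. 1. *A Hilbert desingularization of $\sigma$.* $\Delta$ is a fan of rational strongly convex polyhedral cones with support $\sigma$; it is smooth (each cone is generated by part of a $\mathbb Z$-basis of $N$); and the set of primitive generators in $N$ of the rays of $\Delta$ is exactly the Hilbert basis of $\sigma$, i.e. the set of nonzero elements of $\sigma\cap N$ that are not a sum of two nonzero elements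 of $\sigma\cap N$. 2. *An iterated Fujiki–Oka resolution.* There is a subgroup $H\le G$, with lattice $N_H\subset N$ defined like $N$, and a Fujiki–Oka resolution of $\sigma$ with respect to $N_H$, such that each maximal cone $\tau$ of this resolution has a Fujiki–Oka resolution with respect to $N$, and $\Delta$ consists of all faces of the maximal cones of the latter resolutions. Here a *Fujiki–Oka resolution* of a simplicial three-dimensional cone with respect to a lattice $L$ is obtained as follows. Let $v_1,v_2,v_3$ be the primitive generators in $L$ of its rays, and choose an index $i$. If $v_1,v_2,v_3$ generate $L$, the cone is left as it is. Otherwise the cone must be semi-unimodular over $v_i$: $L$ is generated by $v_1,v_2,v_3$ and an *Oka center* $c=\frac1s(b_1v_1+b_2v_2+b_3v_3)$ with integers $s>1$, $0\le b_j<s$ and $b_i=1$. The cone is replaced by the cones obtained from $(v_1,v_2,v_3)$ by replacing some $v_j$ with $b_j\ne 0$ by $c$, and the procedure is repeated on each of these with the same index $i$, until all cones are smooth. -/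

import Mathlib

/-- The real vector space `N_ℝ = ℝ³`. -/
abbrev V := Fin 3 → ℝ

/-! ### The lattice of a cyclic quotient singularity -/

/-- The lattice `N` of the toric variety `ℂ³/G`, where `P` is a change of coordinates that
diagonalizes `G`: the vectors `v ∈ ℝ³` such that `diag(e^{2πi v₁}, e^{2πi v₂}, e^{2πi v₃})` is an
element of `G` written in the new coordinates. If `G` is of type `1/r (a₁, a₂, a₃)`, this is
`ℤ³ + ℤ · (1/r) (a₁, a₂, a₃)`. -/
noncomputable def weightLattice (P : GL (Fin 3) ℂ) (G : Subgroup (GL (Fin 3) ℂ)) :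
    AddSubgroup V where
  carrier := {v | ∃ g ∈ G, ((P * g * P⁻¹ : GL (Fin 3) ℂ) : Matrix (Fin 3) (Fin 3) ℂ) =
    Matrix.diagonal fun i => Complex.exp (2 * Real.pi * Complex.I * (v i : ℂ))}
  zero_mem' := ⟨1, G.one_mem, by simp⟩
  add_mem' := by
    rintro v w ⟨g, hg, hv⟩ ⟨h, hh, hw⟩
    refine ⟨g * h, G.mul_mem hg hh, ?_⟩
    have e : P * (g * h) * P⁻¹ = (P * g * P⁻¹) * (P * h * P⁻¹) := by group
    rw [e, Units.val_mul, hv, hw, Matrix.diagonal_mul_diagonal]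
    congr 1
    funext i
    rw [← Complex.exp_add]
    congr 1
    simp only [Pi.add_apply, Complex.ofReal_add]
    ring
  neg_mem' := by
    rintro v ⟨g, hg, hv⟩
    refine ⟨g⁻¹, G.inv_mem hg, ?_⟩
    have e : P * g⁻¹ * P⁻¹ = (P * g * P⁻¹)⁻¹ := by group
    rw [e]
    apply Units.inv_eq_of_mul_eq_one_right
    rw [hv, Matrix.diagonal_mul_diagonal, ← Matrix.diagonal_one]
    congr 1
    funext i
    rw [← Complex.exp_add]
    simp

/-- The age of a vector: the sum of its components. -/
def age (v : V) : ℝ := ∑ i, v i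

/-- The cone `σ` of `ℂ³/G`: the positive orthant. -/
noncomputable def orthant : PointedCone ℝ V := PointedCone.positive ℝ V

/-- `ℂ³/G`, with lattice `N`, has at most canonical singularities (the criterion of Reid and Tai
for groups without quasi-reflections, i.e. for lattices in which the standard basis vectors are
primitive). The exceptional toric divisor of a primitive `v ∈ N ∩ σ` has discrepancy `age v - 1`,
so the condition is that every nonzero point of `N ∩ σ` has age at least `1`. It implies that the
standard basis vectors are primitive in `N`. -/
def IsCanonical (N : AddSubgroup V) : Prop :=
  ∀ v ∈ N, v ∈ orthant → v ≠ 0 → 1 ≤ age v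

/-! ### Hilbert bases, fans, Hilbert desingularizations -/

/-- The Hilbert basis of the cone `σ` with reference to `N`: the nonzero points of `σ ∩ N` that are
not a sum of two nonzero points of `σ ∩ N`. -/
def hilbertBasis (N : AddSubgroup V) (σ : PointedCone ℝ V) : Set V :=
  {ν | ν ∈ σ ∧ ν ∈ N ∧ ν ≠ 0 ∧
    ¬ ∃ x y : V, (x ∈ σ ∧ x ∈ N ∧ x ≠ 0) ∧ (y ∈ σ ∧ y ∈ N ∧ y ≠ 0) ∧ ν = x + y}

/-- `v` is a primitive element of `N`: the first nonzero point of `N` on the ray through `v`. -/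
def IsPrimitive (N : AddSubgroup V) (v : V) : Prop :=
  v ∈ N ∧ v ≠ 0 ∧ ∀ t : ℝ, 0 < t → t < 1 → t • v ∉ N

/-- `Δ` is a fan of rational strongly convex polyhedral cones (with respect to `N`). -/
structure IsFan (N : AddSubgroup V) (Δ : Set (PointedCone ℝ V)) : Prop where
  finite : Δ.Finite
  rational : ∀ σ ∈ Δ, ∃ S : Set V, S.Finite ∧ S ⊆ N ∧ σ = PointedCone.hull ℝ S
  stronglyConvex : ∀ σ ∈ Δ, σ.lineal = ⊥
  face_mem : ∀ σ ∈ Δ, ∀ τ : PointedCone ℝ V, τ.IsFaceOf σ → τ ∈ Δ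
  inter_face : ∀ σ ∈ Δ, ∀ τ ∈ Δ, (σ ⊓ τ).IsFaceOf σ ∧ (σ ⊓ τ).IsFaceOf τ

/-- The fan `Δ` is a subdivision of the cone `σ`: its support is `σ`. -/
def IsSubdivision (N : AddSubgroup V) (Δ : Set (PointedCone ℝ V)) (σ : PointedCone ℝ V) : Prop :=
  IsFan N Δ ∧ ⋃ τ ∈ Δ, (τ : Set V) = (σ : Set V)

/-- `Δ` is smooth: every cone of `Δ` is generated by a part of a `ℤ`-basis of `N`. -/
def IsSmoothFan (N : AddSubgroup V) (Δ : Set (PointedCone ℝ V)) : Prop :=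
  ∀ σ ∈ Δ, ∃ (b : Module.Basis (Fin 3) ℤ N) (s : Set (Fin 3)),
    σ = PointedCone.hull ℝ ((fun i => (b i : V)) '' s)

/-- `Gen(Δ)`: the primitive generators of the one-dimensional cones of `Δ`. -/
def gen (N : AddSubgroup V) (Δ : Set (PointedCone ℝ V)) : Set V :=
  {v | IsPrimitive N v ∧ PointedCone.hull ℝ {v} ∈ Δ}

/-- `Δ` is a Hilbert desingularization of `σ`. -/
def IsHilbertDesingularization (N : AddSubgroup V) (σ : PointedCone ℝ V)
    (Δ : Set (PointedCone ℝ V)) : Prop :=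
  IsSubdivision N Δ σ ∧ IsSmoothFan N Δ ∧ gen N Δ = hilbertBasis N σ

/-! ### Fujiki–Oka resolutions -/

/-- The point `(1/r) (a₁ v₁ + a₂ v₂ + a₃ v₃)` of the cone generated by `v₁, v₂, v₃`. -/
noncomputable def okaCenter (v : Fin 3 → V) (r : ℕ) (a : Fin 3 → ℕ) : V :=
  ∑ j, ((a j : ℝ) / (r : ℝ)) • v j

/-- `FujikiOka N i v T`: running the Fujiki–Oka algorithm over the `i`-th ray on the simplicial cone
with generators `v 0, v 1, v 2` produces the set `T` of (triples of generators of) maximal cones.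

* If `v` generates `N`, the cone is smooth and the algorithm stops.
* Otherwise the cone has to be semi-unimodular over `v i`, i.e. of type `1/r (a₁, a₂, a₃)` with
  `0 ≤ a_j < r` and `a_i = 1`. The algorithm blows up the Oka center `c`, i.e. it replaces the cone
  by the cones with generators `v` in which some `v j` with `a_j ≠ 0` is replaced by `c`, and goes on
  with each of these over the `i`-th ray. The cone for `j = i` is smooth. The cone for `j ≠ i`
  has index `a_j`, and its proper fraction is the `j`-th remainder of `(a₁, a₂, a₃) / r`. -/
inductive FujikiOka (N : AddSubgroup V) (i : Fin 3) :
    (Fin 3 → V) → Set (Fin 3 → V) → Prop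
  | smooth (v : Fin 3 → V) (hN : N = AddSubgroup.closure (Set.range v)) :
      FujikiOka N i v {v}
  | blowup (v : Fin 3 → V) (r : ℕ) (a : Fin 3 → ℕ) (hr : 1 < r) (hi : a i = 1)
      (ha : ∀ j, a j < r)
      (hN : N = AddSubgroup.closure (Set.range v ∪ {okaCenter v r a}))
      (T : Fin 3 → Set (Fin 3 → V))
      (hT : ∀ j, a j ≠ 0 → FujikiOka N i (Function.update v j (okaCenter v r a)) (T j)) :
      FujikiOka N i v (⋃ j, ⋃ (_ : a j ≠ 0), T j)

/-- `T` is the set of maximal cones of a Fujiki–Oka resolution of the three-dimensional simplicial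
cone `σ` with respect to `N`: the algorithm is run on the primitive generators of `σ`, over one of
them for which `σ` is semi-unimodular. -/
def IsFujikiOkaResolution (N : AddSubgroup V) (σ : PointedCone ℝ V)
    (T : Set (Fin 3 → V)) : Prop :=
  ∃ (v : Fin 3 → V) (i : Fin 3), LinearIndependent ℝ v ∧ (∀ j, IsPrimitive N (v j)) ∧
    PointedCone.hull ℝ (Set.range v) = σ ∧ FujikiOka N i v T

/-- All faces of the cones generated by the triples in `T`. -/
def fanOf (T : Set (Fin 3 → V)) : Set (PointedCone ℝ V) :=
  {τ | ∃ t ∈ T, τ.IsFaceOf (PointedCone.hull ℝ (Set.range t))}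

/-- `Δ` is (the fan of) an iterated Fujiki–Oka resolution of `ℂ³/G`. For a subgroup `H` of the cyclic
group `G`, take a Fujiki–Oka resolution of `ℂ³/H`, with maximal cones `T₁`. The same cones, with
respect to the lattice of `G`, form the fan of the toric partial resolution `Y_G` of `ℂ³/G`. Then take
a Fujiki–Oka resolution, with maximal cones `T₂ t`, of each maximal cone of this fan; together they
have to form a subdivision of the orthant. -/
def IsIteratedFujikiOka (P : GL (Fin 3) ℂ) (G : Subgroup (GL (Fin 3) ℂ))
    (Δ : Set (PointedCone ℝ V)) : Prop :=
  ∃ H ≤ G, ∃ T₁ : Set (Fin 3 → V), IsFujikiOkaResolution (weightLattice P H) orthant T₁ ∧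
    ∃ T₂ : (Fin 3 → V) → Set (Fin 3 → V),
      (∀ t ∈ T₁, IsFujikiOkaResolution (weightLattice P G)
        (PointedCone.hull ℝ (Set.range t)) (T₂ t)) ∧
      Δ = fanOf (⋃ t ∈ T₁, T₂ t) ∧
      IsSubdivision (weightLattice P G) Δ orthant

/-!
Write `N` for the lattice of `G` and `σ` for the orthant. All nonzero elements of `N ∩ σ` have
age at least `1`, so those of age less than `2` are irreducible, i.e. belong to the Hilbert basis.
The subgroup `H` and the vertices over which the algorithm is run are chosen in such a way that all
centers have age less than `2`. No classification of canonical singularities is used.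

*Irreducible generators suffice.* A smooth subdivision always uses the whole Hilbert basis, so a
subdivision with irreducible generators is a Hilbert desingularization
(`isHilbertDesingularization_fanOf`). The algorithm works on each cone separately; the resulting
subdivisions agree on common faces because a smooth subdivision of a two-dimensional cone with
irreducible generators is unique (`comb_eq_of_planar`, `faceToFace_of_parts`,
`FujikiOka.triangulation`, `exists_iterated`).

*All ages integral.* Centers of cones with generators of age `1` then have age `1`
(`exists_fujikiOka_of_integral`), so it suffices to find semi-unimodular cones. Let `H` be the
subgroup acting trivially on the first coordinate. Its resolution subdivides the edge opposite to
`e₀` by its lattice points, and over `e₀` each of the resulting cones is semi-unimodular for `G`,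
since `H` is the kernel of the first character (`exists_two_step_of_integral`).

*Some age not integral.* Let `H` be the subgroup of integral ages. Some coordinate is faithful on
`N / ℤ³`: otherwise each of the three edges of the triangle of age `1` has lattice points in its
interior, and the translation lattice they span is so fine that it moves a vector of nonintegral
age to one of age less than `1` in `σ` (`exists_faithful_coordinate`). Hence `H` has a crepant
Fujiki–Oka resolution. On its cones the age is faithful modulo `ℤ`, so the lattice points of the
box spanned by the generators have age `1 + k/m` for `0 < k < m`. The terminal lemma
(`eq_one_of_residues`), proved by counting jumps of floor functions, shows that these cones are of
type `1/m (1, b, -b)`; over the generator of weight `1` all centers have age less than `2`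
(`exists_fujikiOka_of_terminal`).
-/

/-! ### Conic combinations and face-to-face cones -/

/-- The linear combination `∑ w(y) y` with coefficients `w`. -/
noncomputable abbrev comb : (V →₀ ℝ) →ₗ[ℝ] V := Finsupp.linearCombination ℝ id

/-- The cones generated by `S` and `S'` meet face to face, along the cone generated by `S ∩ S'`,
and every point has at most one conic combination of `S` representing it: a point represented
by conic combinations of both sets has the same coefficients in both. -/
def FaceToFace (S S' : Set V) : Prop :=
  ∀ w w' : V →₀ ℝ, (∀ y, 0 ≤ w y) → (∀ y, 0 ≤ w' y) → (w.support : Set V) ⊆ S →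
    (w'.support : Set V) ⊆ S' → comb w = comb w' → w = w'

lemma FaceToFace.symm {S S' : Set V} (h : FaceToFace S S') : FaceToFace S' S :=
  fun w w' hw hw' hs hs' e => (h w' w hw' hw hs' hs e.symm).symm

/-- The basis of `ℝ³` formed by a linearly independent triple. -/
noncomputable def tripleBasis (t : Fin 3 → V) (ht : LinearIndependent ℝ t) :
    Module.Basis (Fin 3) ℝ V :=
  basisOfLinearIndependentOfCardEqFinrank ht (by simp)

@[simp] lemma tripleBasis_apply (t : Fin 3 → V) (ht : LinearIndependent ℝ t) (j : Fin 3) :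
    tripleBasis t ht j = t j := by
  simp [tripleBasis]

lemma sum_coord_smul (t : Fin 3 → V) (ht : LinearIndependent ℝ t) (x : V) :
    ∑ j, (tripleBasis t ht).coord j x • t j = x := by
  simpa using (tripleBasis t ht).sum_repr x

lemma coord_self (t : Fin 3 → V) (ht : LinearIndependent ℝ t) (j k : Fin 3) :
    (tripleBasis t ht).coord j (t k) = if k = j then 1 else 0 := by
  have := (tripleBasis t ht).repr_self k
  rw [tripleBasis_apply] at this
  simp [Module.Basis.coord_apply, this, Finsupp.single_apply]

lemma coord_sum (t : Fin 3 → V) (ht : LinearIndependent ℝ t) (c : Fin 3 → ℝ) (j : Fin 3) :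
    (tripleBasis t ht).coord j (∑ k, c k • t k) = c j := by
  simp [-Module.Basis.coord_apply, map_sum, coord_self]

lemma sum_smul_mem_hull {t : Fin 3 → V} {c : Fin 3 → ℝ} (hc : ∀ j, 0 ≤ c j) :
    ∑ j, c j • t j ∈ PointedCone.hull ℝ (Set.range t) :=
  Submodule.sum_mem _ fun j _ =>
    PointedCone.smul_mem _ (hc j) (PointedCone.subset_hull (Set.mem_range_self j))

lemma mem_hull_range_iff {t : Fin 3 → V} {x : V} :
    x ∈ PointedCone.hull ℝ (Set.range t) ↔
      ∃ c : Fin 3 → ℝ, (∀ j, 0 ≤ c j) ∧ ∑ j, c j • t j = x := by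
  constructor
  · intro h
    obtain ⟨c, hc⟩ := (Submodule.mem_span_range_iff_exists_fun _).1 h
    exact ⟨fun j => (c j : ℝ), fun j => (c j).2, hc⟩
  · rintro ⟨c, hc, rfl⟩
    exact sum_smul_mem_hull hc

lemma mem_hull_iff_coord {t : Fin 3 → V} (ht : LinearIndependent ℝ t) {x : V} :
    x ∈ PointedCone.hull ℝ (Set.range t) ↔ ∀ j, 0 ≤ (tripleBasis t ht).coord j x := by
  rw [mem_hull_range_iff]
  constructor
  · rintro ⟨c, hc, rfl⟩ j
    rw [coord_sum]; exact hc j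
  · intro h
    exact ⟨_, h, sum_coord_smul t ht x⟩

lemma hull_le {t : Fin 3 → V} {C : PointedCone ℝ V} (h : ∀ j, t j ∈ C) :
    PointedCone.hull ℝ (Set.range t) ≤ C :=
  Submodule.span_le.2 (by rintro _ ⟨j, rfl⟩; exact h j)

lemma comb_apply (w : V →₀ ℝ) : comb w = ∑ y ∈ w.support, w y • y := by
  simp [Finsupp.linearCombination_apply, Finsupp.sum]

lemma comb_eq_sum {t : Fin 3 → V} (ht : Function.Injective t) {w : V →₀ ℝ}
    (hw : (w.support : Set V) ⊆ Set.range t) : comb w = ∑ j, w (t j) • t j := by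
  classical
  rw [comb_apply, ← Finset.sum_image (f := fun y => w y • y) (g := t) (s := Finset.univ)
    (fun a _ b _ h => ht h)]
  apply Finset.sum_subset
  · intro y hy
    obtain ⟨j, rfl⟩ := hw hy
    exact Finset.mem_image_of_mem _ (Finset.mem_univ _)
  · intro y _ hy
    simp [Finsupp.notMem_support_iff.1 hy]

/-- The conic combination `∑ c j • t j` of a triple, as a coefficient function on `V`. Equal members
of the triple have their coefficients added. -/
noncomputable def coeffs (t : Fin 3 → V) (c : Fin 3 → ℝ) : V →₀ ℝ :=
  ∑ j, Finsupp.single (t j) (c j)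

lemma comb_coeffs (t : Fin 3 → V) (c : Fin 3 → ℝ) : comb (coeffs t c) = ∑ j, c j • t j := by
  simp [coeffs, map_sum, Finsupp.linearCombination_single]

lemma coeffs_nonneg {t : Fin 3 → V} {c : Fin 3 → ℝ} (hc : ∀ j, 0 ≤ c j) (y : V) :
    0 ≤ coeffs t c y := by
  classical
  rw [coeffs, Finsupp.finsetSum_apply]
  refine Finset.sum_nonneg fun j _ => ?_
  rw [Finsupp.single_apply]
  split_ifs
  exacts [hc j, le_rfl]

lemma coeffs_support (t : Fin 3 → V) (c : Fin 3 → ℝ) :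
    ((coeffs t c).support : Set V) ⊆ Set.range t := by
  classical
  intro y hy
  by_contra hn
  apply Finsupp.mem_support_iff.1 hy
  rw [coeffs, Finsupp.finsetSum_apply]
  refine Finset.sum_eq_zero fun j _ => ?_
  rw [Finsupp.single_apply, if_neg]
  rintro rfl
  exact hn ⟨j, rfl⟩

lemma coeffs_self {t : Fin 3 → V} (ht : Function.Injective t) (c : Fin 3 → ℝ) (k : Fin 3) :
    coeffs t c (t k) = c k := by
  classical
  rw [coeffs, Finsupp.finsetSum_apply]
  simp [Finsupp.single_apply, ht.eq_iff]

lemma eq_coord {t : Fin 3 → V} (ht : LinearIndependent ℝ t) {w : V →₀ ℝ}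
    (hw : (w.support : Set V) ⊆ Set.range t) (j : Fin 3) :
    w (t j) = (tripleBasis t ht).coord j (comb w) := by
  rw [comb_eq_sum ht.injective hw, coord_sum]

lemma faceToFace_self {t : Fin 3 → V} (ht : LinearIndependent ℝ t) :
    FaceToFace (Set.range t) (Set.range t) := by
  intro w w' _ _ hs hs' e
  ext y
  by_cases hy : y ∈ Set.range t
  · obtain ⟨j, rfl⟩ := hy
    rw [eq_coord ht hs, eq_coord ht hs', e]
  · rw [Finsupp.notMem_support_iff.1 fun h => hy (hs h),
      Finsupp.notMem_support_iff.1 fun h => hy (hs' h)]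

/-! ### Faces of simplicial cones and the fan of a face-to-face family -/

/-- A face of a finitely generated cone is generated by the generators it contains. -/
lemma face_eq_hull {t : Fin 3 → V} {τ : PointedCone ℝ V}
    (h : τ.IsFaceOf (PointedCone.hull ℝ (Set.range t))) :
    τ = PointedCone.hull ℝ (t '' {j | t j ∈ τ}) := by
  apply le_antisymm
  · intro x hx
    obtain ⟨c, hc, rfl⟩ := mem_hull_range_iff.1 (h.le hx)
    refine Submodule.sum_mem _ fun j _ => ?_
    rcases (hc j).eq_or_lt with h0 | h0
    · rw [← h0, zero_smul]; exact Submodule.zero_mem _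
    · exact PointedCone.smul_mem _ (hc j) (PointedCone.subset_hull ⟨j,
        h.mem_of_sum_smul_mem (fun j => PointedCone.subset_hull (Set.mem_range_self j)) hc hx j h0,
        rfl⟩)
  · exact Submodule.span_le.2 (by rintro _ ⟨j, hj, rfl⟩; exact hj)

lemma inf_isFaceOf_left {t t' : Fin 3 → V} {σ τ : PointedCone ℝ V}
    (hF : FaceToFace (Set.range t) (Set.range t'))
    (hσ : σ.IsFaceOf (PointedCone.hull ℝ (Set.range t)))
    (hτ : τ.IsFaceOf (PointedCone.hull ℝ (Set.range t'))) : (σ ⊓ τ).IsFaceOf σ := by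
  refine ⟨inf_le_left, ?_⟩
  intro x y a hx hy ha hz
  refine ⟨hx, ?_⟩
  obtain ⟨c, hc, rfl⟩ := mem_hull_range_iff.1 (hσ.le hx)
  obtain ⟨d, hd, rfl⟩ := mem_hull_range_iff.1 (hσ.le hy)
  obtain ⟨e, he, hze⟩ := mem_hull_range_iff.1 (hτ.le hz.2)
  -- the two representations of `z = a x + y` have the same coefficients
  have key : coeffs t (fun j => a * c j + d j) = coeffs t' e := by
    refine hF _ _ (coeffs_nonneg fun j => ?_) (coeffs_nonneg he) (coeffs_support _ _)
      (coeffs_support _ _) ?_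
    · have := hc j; have := hd j; positivity
    · rw [comb_coeffs, comb_coeffs, hze, Finset.smul_sum, ← Finset.sum_add_distrib]
      simp only [add_smul, mul_smul]
  refine Submodule.sum_mem _ fun j _ => ?_
  rcases (hc j).eq_or_lt with h0 | h0
  · rw [← h0, zero_smul]; exact Submodule.zero_mem _
  refine PointedCone.smul_mem _ (hc j) ?_
  have hpos : 0 < coeffs t (fun j => a * c j + d j) (t j) := by
    classical
    rw [coeffs, Finsupp.finsetSum_apply]
    refine Finset.sum_pos' (fun k _ => ?_) ⟨j, Finset.mem_univ _, ?_⟩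
    · rw [Finsupp.single_apply]
      have := hc k; have := hd k
      split_ifs <;> positivity
    · rw [Finsupp.single_eq_same]
      have := hd j; positivity
  have hmem : t j ∈ Set.range t' := by
    rw [key] at hpos
    exact coeffs_support t' e (Finsupp.mem_support_iff.2 hpos.ne')
  obtain ⟨k, hk⟩ := hmem
  -- some `t' k'` equal to `t j` has a positive coefficient, so it lies in the face `τ`
  obtain ⟨k', hk', hek'⟩ : ∃ k', t' k' = t j ∧ 0 < e k' := by
    classical
    by_contra! hcon
    rw [key, coeffs, Finsupp.finsetSum_apply] at hpos
    refine hpos.not_ge (Finset.sum_nonpos fun k _ => ?_)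
    rw [Finsupp.single_apply]
    split_ifs with h
    exacts [hcon k h, le_rfl]
  rw [← hk']
  exact hτ.mem_of_sum_smul_mem (fun j => PointedCone.subset_hull (Set.mem_range_self j)) he
    (hze ▸ hz.2) k' hek'

theorem isFan_fanOf {N : AddSubgroup V} {T : Set (Fin 3 → V)} (hfin : T.Finite)
    (hσ : ∀ t ∈ T, ∀ j, t j ∈ orthant) (hN : ∀ t ∈ T, ∀ j, t j ∈ N)
    (hF : ∀ t ∈ T, ∀ t' ∈ T, FaceToFace (Set.range t) (Set.range t')) : IsFan N (fanOf T) where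
  finite := by
    have : fanOf T ⊆ ⋃ t ∈ T, Set.range fun s : Set (Fin 3) => PointedCone.hull ℝ (t '' s) := by
      rintro τ ⟨t, ht, h⟩
      exact Set.mem_biUnion ht ⟨_, (face_eq_hull h).symm⟩
    exact (hfin.biUnion fun t _ => Set.finite_range _).subset this
  rational := by
    rintro τ ⟨t, ht, h⟩
    refine ⟨_, (Set.toFinite {j | t j ∈ τ}).image t, ?_, face_eq_hull h⟩
    rintro _ ⟨j, _, rfl⟩
    exact hN t ht j
  stronglyConvex := by
    rintro τ ⟨t, ht, h⟩
    have hle : τ ≤ orthant := h.le.trans (hull_le (hσ t ht))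
    rw [eq_bot_iff]
    rintro x ⟨h1, h2⟩
    have h1' : (0 : V) ≤ x := hle h1
    have h2' : (0 : V) ≤ -x := hle h2
    exact le_antisymm (neg_nonneg.1 h2') h1'
  face_mem := by
    rintro σ ⟨t, ht, h⟩ τ hτ
    exact ⟨t, ht, hτ.trans h⟩
  inter_face := by
    rintro σ ⟨t, ht, h⟩ τ ⟨t', ht', h'⟩
    refine ⟨inf_isFaceOf_left (hF t ht t' ht') h h', ?_⟩
    rw [inf_comm]
    exact inf_isFaceOf_left (hF t' ht' t ht) h' h

lemma iUnion_fanOf (T : Set (Fin 3 → V)) :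
    ⋃ τ ∈ fanOf T, (τ : Set V) = ⋃ t ∈ T, (PointedCone.hull ℝ (Set.range t) : Set V) := by
  ext x
  simp only [Set.mem_iUnion, fanOf, Set.mem_ofPred_eq, SetLike.mem_coe, exists_prop]
  constructor
  · rintro ⟨τ, ⟨t, ht, h⟩, hx⟩
    exact ⟨t, ht, h.le hx⟩
  · rintro ⟨t, ht, hx⟩
    exact ⟨_, ⟨t, ht, .rfl⟩, hx⟩

/-! ### Cones generated by a lattice basis of irreducible elements -/

lemma mem_closure_range {t : Fin 3 → V} {y : V} :
    y ∈ AddSubgroup.closure (Set.range t) ↔ ∃ n : Fin 3 → ℤ, ∑ j, (n j : ℝ) • t j = y := by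
  rw [← Submodule.span_int_eq_addSubgroupClosure, Submodule.mem_toAddSubgroup,
    Submodule.mem_span_range_iff_exists_fun]
  simp only [Int.cast_smul_eq_zsmul]

/-- A Hilbert triple: a `ℤ`-basis of the lattice `N` consisting of elements of the Hilbert basis of
the orthant. -/
structure IsHilbertTriple (N : AddSubgroup V) (t : Fin 3 → V) : Prop where
  linInd : LinearIndependent ℝ t
  closure : N = AddSubgroup.closure (Set.range t)
  mem : ∀ j, t j ∈ hilbertBasis N orthant

lemma age_add (x y : V) : age (x + y) = age x + age y := by
  simp [age, Finset.sum_add_distrib]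

lemma mem_hilbertBasis_of_age_lt {N : AddSubgroup V} (hcan : IsCanonical N) {x : V} (hN : x ∈ N)
    (hx : x ∈ orthant) (h0 : x ≠ 0) (h2 : age x < 2) : x ∈ hilbertBasis N orthant := by
  refine ⟨hx, hN, h0, ?_⟩
  rintro ⟨y, z, ⟨hy, hyN, hy0⟩, ⟨hz, hzN, hz0⟩, rfl⟩
  have := hcan y hyN hy hy0
  have := hcan z hzN hz hz0
  rw [age_add] at h2
  linarith

/-- In a cone generated by a lattice basis, the irreducible elements are the generators. -/
lemma IsHilbertTriple.eq_of_mem_hull {N : AddSubgroup V} {t : Fin 3 → V} (h : IsHilbertTriple N t)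
    {y : V} (hy : y ∈ hilbertBasis N orthant) (hyt : y ∈ PointedCone.hull ℝ (Set.range t)) :
    ∃ j, t j = y := by
  obtain ⟨-, hyN, hy0, hirr⟩ := hy
  have hyN' := hyN
  rw [h.closure, mem_closure_range] at hyN
  obtain ⟨n, rfl⟩ := hyN
  have hn : ∀ j, (0 : ℤ) ≤ n j := fun j => by
    have := (mem_hull_iff_coord h.linInd).1 hyt j
    rw [coord_sum t h.linInd (fun j => (n j : ℝ))] at this
    exact_mod_cast this
  obtain ⟨j, hj⟩ : ∃ j, n j ≠ 0 := by
    by_contra! hall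
    exact hy0 (by simp [hall])
  refine ⟨j, ?_⟩
  by_contra hne
  have hsub : ∑ k, (n k : ℝ) • t k - t j ∈ PointedCone.hull ℝ (Set.range t) := by
    rw [mem_hull_iff_coord h.linInd]
    intro k
    rw [map_sub, coord_sum t h.linInd (fun j => (n j : ℝ)), coord_self]
    split_ifs with hk
    · subst hk
      have : (1 : ℤ) ≤ n j := by have := hn j; omega
      have : (1 : ℝ) ≤ n j := by exact_mod_cast this
      linarith
    · have := hn k
      have : (0 : ℝ) ≤ n k := by exact_mod_cast this
      linarith
  refine hirr ⟨t j, ∑ k, (n k : ℝ) • t k - t j, ⟨(h.mem j).1, (h.mem j).2.1, (h.mem j).2.2.1⟩,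
    ⟨hull_le (fun j => (h.mem j).1) hsub, N.sub_mem hyN' (h.mem j).2.1, ?_⟩, by simp⟩
  exact fun h0 => hne (sub_eq_zero.1 h0).symm

/-! ### Two-dimensional cones have a unique Hilbert subdivision -/

/-- In a planar cone with coordinates `A, B ≥ 0`, a vector whose slope `B / (A + B)` lies between
the slopes of `m` and `M` is a conic combination of `m` and `M`. -/
lemma exists_conic_of_slope {A B : V → ℝ} {p q m M y : V}
    (hm : m = A m • p + B m • q) (hM : M = A M • p + B M • q) (hy : y = A y • p + B y • q)
    (hm0 : 0 < A m + B m) (hM0 : 0 < A M + B M) (hy0 : 0 < A y + B y)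
    (h1 : B m / (A m + B m) ≤ B y / (A y + B y)) (h2 : B y / (A y + B y) ≤ B M / (A M + B M)) :
    ∃ c d : ℝ, 0 ≤ c ∧ 0 ≤ d ∧ y = c • m + d • M := by
  have key : ∀ z : V, z = A z • p + B z • q → 0 < A z + B z →
      z = (A z + B z) • (p + (B z / (A z + B z)) • (q - p)) := by
    intro z hz hz0
    have e : (A z + B z) * (B z / (A z + B z)) = B z := by field_simp
    rw [smul_add, smul_smul, e]
    conv_lhs => rw [hz]
    module
  have ekey := key y hy hy0
  have mkey := key m hm hm0
  have Mkey := key M hM hM0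
  set sm := B m / (A m + B m)
  set sM := B M / (A M + B M)
  set sy := B y / (A y + B y)
  set a := A m + B m
  set b := A M + B M
  set h := A y + B y
  rcases eq_or_lt_of_le (h1.trans h2) with heq | hlt
  · refine ⟨h / a, 0, by positivity, le_rfl, ?_⟩
    have : sy = sm := le_antisymm (h2.trans heq.ge) h1
    rw [ekey, this, mkey, smul_smul, zero_smul, add_zero, div_mul_cancel₀ _ hm0.ne']
  · have hd : 0 < sM - sm := sub_pos.2 hlt
    refine ⟨h * ((sM - sy) / (sM - sm)) / a, h * ((sy - sm) / (sM - sm)) / b, ?_, ?_, ?_⟩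
    · have := sub_nonneg.2 h2; positivity
    · have := sub_nonneg.2 h1; positivity
    · rw [ekey, mkey, Mkey, smul_smul, smul_smul, div_mul_cancel₀ _ hm0.ne',
        div_mul_cancel₀ _ hM0.ne']
      have e1 : (sM - sy) / (sM - sm) = 1 - (sy - sm) / (sM - sm) := by field_simp; ring
      have e2 : sy = sm + ((sy - sm) / (sM - sm)) * (sM - sm) := by field_simp; ring
      rw [e1]
      generalize (sy - sm) / (sM - sm) = θ at e2
      rw [e2]
      module

/-- Let two conic combinations of Hilbert triples represent the same vector, and let all the
vectors involved lie in a planar cone. Then the vector with the smallest slope that only one of them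
uses lies between two vectors of the other, so it is reducible unless there is none. -/
lemma comb_eq_of_planar {N : AddSubgroup V} {t t' : Fin 3 → V} (ht : IsHilbertTriple N t)
    (ht' : IsHilbertTriple N t') (A B : V →ₗ[ℝ] ℝ) (p q : V) {w w' : V →₀ ℝ}
    (hw : ∀ y, 0 ≤ w y) (hw' : ∀ y, 0 ≤ w' y) (hs : (w.support : Set V) ⊆ Set.range t)
    (hs' : (w'.support : Set V) ⊆ Set.range t')
    (hA : ∀ y, y ∈ w.support ∨ y ∈ w'.support → 0 ≤ A y ∧ 0 ≤ B y ∧ y = A y • p + B y • q)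
    (e : comb w = comb w') : w = w' := by
  classical
  -- remove the common part
  set u : V →₀ ℝ := w ⊓ w' with hu
  set v := w - u with hv
  set v' := w' - u with hv'
  have hux : ∀ y, u y = min (w y) (w' y) := fun y => Finsupp.inf_apply w w' y
  have hvx : ∀ y, v y = w y - min (w y) (w' y) := fun y => by
    rw [hv, Finsupp.sub_apply, hux]
  have hvx' : ∀ y, v' y = w' y - min (w y) (w' y) := fun y => by
    rw [hv', Finsupp.sub_apply, hux]
  have hv0 : ∀ y, 0 ≤ v y := fun y => by rw [hvx]; linarith [min_le_left (w y) (w' y)]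
  have hv0' : ∀ y, 0 ≤ v' y := fun y => by rw [hvx']; linarith [min_le_right (w y) (w' y)]
  have hvs : ∀ y ∈ v.support, y ∈ w.support := fun y hy => by
    rw [Finsupp.mem_support_iff] at hy ⊢
    intro h0
    rw [hvx, h0, min_eq_left (hw' y)] at hy
    simp at hy
  have hvs' : ∀ y ∈ v'.support, y ∈ w'.support := fun y hy => by
    rw [Finsupp.mem_support_iff] at hy ⊢
    intro h0
    rw [hvx', h0, min_eq_right (hw y)] at hy
    simp at hy
  have hdisj : ∀ y, y ∈ v.support → y ∈ v'.support → False := fun y hy hy' => by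
    rw [Finsupp.mem_support_iff] at hy hy'
    rw [hvx] at hy; rw [hvx'] at hy'
    rcases le_total (w y) (w' y) with h | h
    · exact hy (by rw [min_eq_left h]; simp)
    · exact hy' (by rw [min_eq_right h]; simp)
  have ev : comb v = comb v' := by rw [hv, hv', map_sub, map_sub, e]
  have hsum : ∀ (f : V →ₗ[ℝ] ℝ), ∑ y ∈ v.support, v y * f y = ∑ y ∈ v'.support, v' y * f y := by
    intro f
    have := congrArg f ev
    simpa [comb_apply, map_sum] using this
  have hpos : ∀ y, y ∈ w.support ∨ y ∈ w'.support → 0 < A y + B y := by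
    intro y hy
    obtain ⟨h1, h2, h3⟩ := hA y hy
    have hy0 : y ≠ 0 := by
      rcases hy with hy | hy
      · obtain ⟨j, rfl⟩ := hs hy; exact (ht.mem j).2.2.1
      · obtain ⟨j, rfl⟩ := hs' hy; exact (ht'.mem j).2.2.1
    refine (add_nonneg h1 h2).lt_of_ne fun h => hy0 ?_
    have hA0 : A y = 0 := by linarith
    have hB0 : B y = 0 := by linarith
    exact h3.trans (by rw [hA0, hB0]; simp)
  have hvpos : ∀ y ∈ v.support, 0 < v y := fun y hy =>
    (hv0 y).lt_of_ne (Finsupp.mem_support_iff.1 hy).symm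
  have hvpos' : ∀ y ∈ v'.support, 0 < v' y := fun y hy =>
    (hv0' y).lt_of_ne (Finsupp.mem_support_iff.1 hy).symm
  have hAB := hsum (A + B)
  have hnonempty : v.support.Nonempty ↔ v'.support.Nonempty := by
    constructor
    · intro h
      by_contra hn
      rw [Finset.not_nonempty_iff_eq_empty] at hn
      rw [hn, Finset.sum_empty] at hAB
      exact (Finset.sum_pos (fun y hy => mul_pos (hvpos y hy) (hpos y (.inl (hvs y hy)))) h).ne' hAB
    · intro h
      by_contra hn
      rw [Finset.not_nonempty_iff_eq_empty] at hn
      rw [hn, Finset.sum_empty] at hAB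
      exact (Finset.sum_pos (fun y hy => mul_pos (hvpos' y hy) (hpos y (.inr (hvs' y hy)))) h).ne
        hAB
  by_cases hne : v.support.Nonempty
  swap
  · have h1 : v = 0 := by
      rwa [Finset.not_nonempty_iff_eq_empty, Finsupp.support_eq_empty] at hne
    have h2 : v' = 0 := by
      rwa [hnonempty, Finset.not_nonempty_iff_eq_empty, Finsupp.support_eq_empty] at hne
    rw [sub_eq_zero.1 (hv ▸ h1 : w - u = 0), sub_eq_zero.1 (hv' ▸ h2 : w' - u = 0)]
  exfalso
  have hne' := hnonempty.1 hne
  set s : V → ℝ := fun y => B y / (A y + B y) with hsdef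
  obtain ⟨m, hm, hmin⟩ := Finset.exists_min_image _ s hne
  obtain ⟨M, hM, hmax⟩ := Finset.exists_max_image _ s hne
  obtain ⟨m', hm', hmin'⟩ := Finset.exists_min_image _ s hne'
  obtain ⟨M', hM', hmax'⟩ := Finset.exists_max_image _ s hne'
  have hBs : ∀ y, y ∈ w.support ∨ y ∈ w'.support → B y = s y * (A y + B y) := fun y hy => by
    have := (hpos y hy).ne'
    simp only [hsdef]; field_simp
  -- both slope intervals contain the slope of the common vector
  have hle : s m' ≤ s M := by
    by_contra! hlt
    have h := hsum (B - s M • (A + B))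
    have h1 : ∑ y ∈ v.support, v y * (B - s M • (A + B)) y ≤ 0 := by
      refine Finset.sum_nonpos fun y hy => mul_nonpos_of_nonneg_of_nonpos (hv0 y) ?_
      have e1 := hBs y (.inl (hvs y hy))
      have e2 := hpos y (.inl (hvs y hy))
      have e3 := hmax y hy
      simp only [LinearMap.sub_apply, LinearMap.smul_apply, LinearMap.add_apply, smul_eq_mul]
      nlinarith
    have h2 : 0 < ∑ y ∈ v'.support, v' y * (B - s M • (A + B)) y := by
      refine Finset.sum_pos (fun y hy => mul_pos (hvpos' y hy) ?_) hne'
      have e1 := hBs y (.inr (hvs' y hy))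
      have e2 := hpos y (.inr (hvs' y hy))
      have e3 := hmin' y hy
      simp only [LinearMap.sub_apply, LinearMap.smul_apply, LinearMap.add_apply, smul_eq_mul]
      nlinarith
    linarith
  have hle' : s m ≤ s M' := by
    by_contra! hlt
    have h := hsum (B - s M' • (A + B))
    have h1 : ∑ y ∈ v'.support, v' y * (B - s M' • (A + B)) y ≤ 0 := by
      refine Finset.sum_nonpos fun y hy => mul_nonpos_of_nonneg_of_nonpos (hv0' y) ?_
      have e1 := hBs y (.inr (hvs' y hy))
      have e2 := hpos y (.inr (hvs' y hy))
      have e3 := hmax' y hy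
      simp only [LinearMap.sub_apply, LinearMap.smul_apply, LinearMap.add_apply, smul_eq_mul]
      nlinarith
    have h2 : 0 < ∑ y ∈ v.support, v y * (B - s M' • (A + B)) y := by
      refine Finset.sum_pos (fun y hy => mul_pos (hvpos y hy) ?_) hne
      have e1 := hBs y (.inl (hvs y hy))
      have e2 := hpos y (.inl (hvs y hy))
      have e3 := hmin y hy
      simp only [LinearMap.sub_apply, LinearMap.smul_apply, LinearMap.add_apply, smul_eq_mul]
      nlinarith
    linarith
  -- an irreducible vector between two generators of a smooth cone is one of them
  have main : ∀ (t : Fin 3 → V), IsHilbertTriple N t → ∀ a b y, a ∈ Set.range t → b ∈ Set.range t →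
      y ∈ hilbertBasis N orthant → (∃ c d : ℝ, 0 ≤ c ∧ 0 ≤ d ∧ y = c • a + d • b) →
      y = a ∨ y = b := by
    rintro t ht _ _ y ⟨j, rfl⟩ ⟨k, rfl⟩ hy ⟨c, d, hc, hd, rfl⟩
    obtain ⟨l, hl⟩ := ht.eq_of_mem_hull hy (Submodule.add_mem _
      (PointedCone.smul_mem _ hc (PointedCone.subset_hull (Set.mem_range_self j)))
      (PointedCone.smul_mem _ hd (PointedCone.subset_hull (Set.mem_range_self k))))
    have h1 := congrArg ((tripleBasis t ht.linInd).coord l) hl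
    rw [map_add, map_smul, map_smul, coord_self, coord_self, coord_self] at h1
    rw [← hl]
    by_cases hj : j = l
    · exact .inl (by rw [hj])
    · by_cases hk : k = l
      · exact .inr (by rw [hk])
      · simp [hj, hk] at h1
  have hHB : ∀ y, y ∈ w.support ∨ y ∈ w'.support → y ∈ hilbertBasis N orthant := by
    rintro y (hy | hy)
    · obtain ⟨j, rfl⟩ := hs hy; exact ht.mem j
    · obtain ⟨j, rfl⟩ := hs' hy; exact ht'.mem j
  have im := Or.inl (b := m ∈ w'.support) (hvs m hm)
  have iM := Or.inl (b := M ∈ w'.support) (hvs M hM)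
  have im' := Or.inr (a := m' ∈ w.support) (hvs' m' hm')
  have iM' := Or.inr (a := M' ∈ w.support) (hvs' M' hM')
  rcases le_total (s m) (s m') with hmm | hmm
  · rcases main t ht m M m' (hs (hvs m hm)) (hs (hvs M hM)) (hHB _ im')
      (exists_conic_of_slope (hA _ im).2.2 (hA _ iM).2.2 (hA _ im').2.2 (hpos _ im) (hpos _ iM)
        (hpos _ im') hmm hle) with h | h
    · exact hdisj m hm (h ▸ hm')
    · exact hdisj M hM (h ▸ hm')
  · rcases main t' ht' m' M' m (hs' (hvs' m' hm')) (hs' (hvs' M' hM')) (hHB _ im)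
      (exists_conic_of_slope (hA _ im').2.2 (hA _ iM').2.2 (hA _ im).2.2 (hpos _ im') (hpos _ iM')
        (hpos _ im) hmm hle') with h | h
    · exact hdisj m hm (h ▸ hm')
    · exact hdisj m hm (h ▸ hM')

/-! ### Gluing subdivisions of adjacent cones -/

lemma comb_coord {w : V →₀ ℝ} (f : V →ₗ[ℝ] ℝ) : f (comb w) = ∑ y ∈ w.support, w y * f y := by
  simp [comb_apply, map_sum]

/-- If a nonnegative functional vanishes on a conic combination, it vanishes on its terms. -/
lemma eq_zero_of_comb {w : V →₀ ℝ} (hw : ∀ y, 0 ≤ w y) {f : V →ₗ[ℝ] ℝ}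
    (hf : ∀ y ∈ w.support, 0 ≤ f y) (h0 : f (comb w) = 0) {y : V} (hy : y ∈ w.support) :
    f y = 0 := by
  rw [comb_coord, Finset.sum_eq_zero_iff_of_nonneg fun y hy => mul_nonneg (hw y) (hf y hy)] at h0
  exact (mul_eq_zero.1 (h0 y hy)).resolve_left (Finsupp.mem_support_iff.1 hy)

lemma comb_mem_hull {S : Set V} {C : PointedCone ℝ V} {w : V →₀ ℝ} (hw : ∀ y, 0 ≤ w y)
    (hs : (w.support : Set V) ⊆ S) (hS : ∀ y ∈ S, y ∈ C) : comb w ∈ C := by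
  rw [comb_apply]
  exact Submodule.sum_mem _ fun y hy => PointedCone.smul_mem _ (hw y) (hS y (hs hy))

/-- Hilbert triples in two different cones that meet face to face also meet face to face. -/
lemma faceToFace_of_parts {N : AddSubgroup V} {s s' t t' : Fin 3 → V}
    (hs : LinearIndependent ℝ s) (hs' : LinearIndependent ℝ s')
    (h : FaceToFace (Set.range s) (Set.range s')) {k : Fin 3} (hk : s k ∉ Set.range s')
    (ht : ∀ j, t j ∈ PointedCone.hull ℝ (Set.range s))
    (ht' : ∀ j, t' j ∈ PointedCone.hull ℝ (Set.range s'))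
    (hN : IsHilbertTriple N t) (hN' : IsHilbertTriple N t') :
    FaceToFace (Set.range t) (Set.range t') := by
  intro w w' hw hw' hws hws' e
  set φ := (tripleBasis s hs).coord with hφ
  set ψ := (tripleBasis s' hs').coord with hψ
  have hmem : ∀ y ∈ w.support, y ∈ PointedCone.hull ℝ (Set.range s) := fun y hy => by
    obtain ⟨j, rfl⟩ := hws hy; exact ht j
  have hmem' : ∀ y ∈ w'.support, y ∈ PointedCone.hull ℝ (Set.range s') := fun y hy => by
    obtain ⟨j, rfl⟩ := hws' hy; exact ht' j
  have hx : comb w ∈ PointedCone.hull ℝ (Set.range s) := comb_mem_hull hw subset_rfl hmem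
  have hx' : comb w ∈ PointedCone.hull ℝ (Set.range s') :=
    e ▸ comb_mem_hull hw' subset_rfl hmem'
  -- the coordinates of the common vector in the two cones
  have heq : coeffs s (fun j => φ j (comb w)) = coeffs s' (fun j => ψ j (comb w)) := by
    refine h _ _ (coeffs_nonneg ((mem_hull_iff_coord hs).1 hx))
      (coeffs_nonneg ((mem_hull_iff_coord hs').1 hx')) (coeffs_support _ _) (coeffs_support _ _) ?_
    rw [comb_coeffs, comb_coeffs, sum_coord_smul, sum_coord_smul]
  have hk0 : φ k (comb w) = 0 := by
    rw [← coeffs_self hs.injective (fun j => φ j (comb w)) k, heq]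
    exact Finsupp.notMem_support_iff.1 fun h => hk (coeffs_support _ _ h)
  -- everything lies in the cone of the two generators of `s` other than `s k`
  have hface : ∀ y, y ∈ w.support ∨ y ∈ w'.support → φ k y = 0 ∧ ∀ j, 0 ≤ φ j y := by
    rintro y (hy | hy)
    · have := fun y hy => (mem_hull_iff_coord hs).1 (hmem y hy)
      exact ⟨eq_zero_of_comb hw (fun y hy => this y hy k) hk0 hy, this y hy⟩
    · have hψ0 := fun y hy => (mem_hull_iff_coord hs').1 (hmem' y hy)
      have hterm : ∀ l, ψ l y = 0 ∨ ∃ j, j ≠ k ∧ s j = s' l := by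
        intro l
        by_cases hl : ψ l (comb w) = 0
        · exact .inl (eq_zero_of_comb hw' (fun y hy => hψ0 y hy l) (e ▸ hl) hy)
        · right
          rw [← coeffs_self hs'.injective (fun j => ψ j (comb w)) l, ← heq] at hl
          obtain ⟨j, hj⟩ := coeffs_support _ _ (Finsupp.mem_support_iff.2 hl)
          refine ⟨j, ?_, hj⟩
          rintro rfl
          exact hk ⟨l, hj.symm⟩
      have hval : ∀ j, φ j y = ∑ l, ψ l y * φ j (s' l) := fun j => by
        conv_lhs => rw [← sum_coord_smul s' hs' y]
        simp [-Module.Basis.coord_apply, map_sum, hψ]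
      constructor
      · rw [hval]
        refine Finset.sum_eq_zero fun l _ => ?_
        rcases hterm l with h | ⟨j, hj, hjl⟩
        · rw [h, zero_mul]
        · rw [← hjl, hφ, coord_self, if_neg hj, mul_zero]
      · intro j
        rw [hval]
        refine Finset.sum_nonneg fun l _ => ?_
        rcases hterm l with h | ⟨j', hj, hjl⟩
        · rw [h, zero_mul]
        · refine mul_nonneg (hψ0 y hy l) ?_
          rw [← hjl, hφ, coord_self]
          split_ifs <;> norm_num
  obtain ⟨a, b, hab⟩ : ∃ a b : Fin 3, ∀ f : Fin 3 → V, ∑ j, f j = f k + f a + f b := by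
    fin_cases k
    · exact ⟨1, 2, fun f => by simp [Fin.sum_univ_three]⟩
    · exact ⟨0, 2, fun f => by simp [Fin.sum_univ_three]; abel⟩
    · exact ⟨0, 1, fun f => by simp [Fin.sum_univ_three]; abel⟩
  refine comb_eq_of_planar hN hN' (φ a) (φ b) (s a) (s b) hw hw' hws hws' (fun y hy => ?_) e
  obtain ⟨h1, h2⟩ := hface y hy
  refine ⟨h2 a, h2 b, ?_⟩
  have := sum_coord_smul s hs y
  rw [hab, ← hφ, h1, zero_smul, zero_add] at this
  exact this.symm

/-! ### The star subdivision at an Oka center -/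

lemma coord_sum_update {v : Fin 3 → V} (hv : LinearIndependent ℝ v) (c : V) (g : Fin 3 → ℝ)
    (j k : Fin 3) :
    (tripleBasis v hv).coord k (∑ m, g m • Function.update v j c m) =
      g k + g j * ((tripleBasis v hv).coord k c - if j = k then 1 else 0) := by
  have : ∑ m, g m • Function.update v j c m = ∑ m, g m • v m + g j • (c - v j) := by
    fin_cases j <;> simp [Fin.sum_univ_three, Function.update] <;> module
  rw [this, map_add, coord_sum, map_smul, map_sub, coord_self, smul_eq_mul]

lemma linearIndependent_update {v : Fin 3 → V} (hv : LinearIndependent ℝ v) {c : V}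
    {j : Fin 3} (hc : (tripleBasis v hv).coord j c ≠ 0) :
    LinearIndependent ℝ (Function.update v j c) := by
  rw [Fintype.linearIndependent_iff]
  intro g hg
  have key := fun k => coord_sum_update hv c g j k
  simp only [hg, map_zero] at key
  have hj : g j = 0 := by
    have := key j
    rw [if_pos rfl] at this
    have h2 : g j * (tripleBasis v hv).coord j c = 0 := by linarith
    exact (mul_eq_zero.1 h2).resolve_right hc
  intro k
  have := key k
  rw [hj] at this
  linarith

lemma coord_okaCenter {v : Fin 3 → V} (hv : LinearIndependent ℝ v) (r : ℕ) (a : Fin 3 → ℕ)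
    (k : Fin 3) :
    (tripleBasis v hv).coord k (okaCenter v r a) = (a k : ℝ) / r := by
  rw [okaCenter, coord_sum v hv (fun j => (a j : ℝ) / r)]

lemma okaCenter_mem_hull {v : Fin 3 → V} (r : ℕ) (a : Fin 3 → ℕ) :
    okaCenter v r a ∈ PointedCone.hull ℝ (Set.range v) :=
  sum_smul_mem_hull fun j => by positivity

lemma hull_update_le {v : Fin 3 → V} (r : ℕ) (a : Fin 3 → ℕ) (j : Fin 3) :
    PointedCone.hull ℝ (Set.range (Function.update v j (okaCenter v r a))) ≤
      PointedCone.hull ℝ (Set.range v) := by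
  refine hull_le fun k => ?_
  by_cases hk : k = j
  · subst hk; simpa using okaCenter_mem_hull r a
  · rw [Function.update_of_ne hk]; exact PointedCone.subset_hull (Set.mem_range_self k)

/-- The cones of the star subdivision cover the cone. -/
lemma exists_mem_hull_update {v : Fin 3 → V} {r : ℕ} (hr : 1 < r) {a : Fin 3 → ℕ} {i : Fin 3}
    (hi : a i ≠ 0) {x : V} (hx : x ∈ PointedCone.hull ℝ (Set.range v)) :
    ∃ j, a j ≠ 0 ∧
      x ∈ PointedCone.hull ℝ (Set.range (Function.update v j (okaCenter v r a))) := by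
  obtain ⟨x, hx0, rfl⟩ := mem_hull_range_iff.1 hx
  obtain ⟨j, hj, hmin⟩ := Finset.exists_min_image (Finset.univ.filter fun j => a j ≠ 0)
    (fun j => x j / a j) ⟨i, by simpa using hi⟩
  simp only [Finset.mem_filter, Finset.mem_univ, true_and] at hj hmin
  refine ⟨j, hj, ?_⟩
  set l := x j / a j with hl
  have hl0 : 0 ≤ l := div_nonneg (hx0 j) (by positivity)
  have hr0 : (r : ℝ) ≠ 0 := by positivity
  have e : ∑ k, x k • v k = ∑ k, (x k - l * a k) • v k + (l * r) • okaCenter v r a := by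
    rw [okaCenter, Finset.smul_sum, ← Finset.sum_add_distrib]
    refine Finset.sum_congr rfl fun k _ => ?_
    rw [smul_smul, ← add_smul]
    congr 1
    field_simp
    ring
  rw [e]
  refine Submodule.add_mem _ (Submodule.sum_mem _ fun k _ => ?_)
    (PointedCone.smul_mem _ (by positivity) (PointedCone.subset_hull ⟨j, by simp⟩))
  by_cases hk : k = j
  · have hj' : (a j : ℝ) ≠ 0 := by exact_mod_cast hj
    have : x k - l * a k = 0 := by rw [hk, hl, div_mul_cancel₀ _ hj', sub_self]
    rw [this, zero_smul]
    exact Submodule.zero_mem _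
  · refine PointedCone.smul_mem _ ?_ (PointedCone.subset_hull ⟨k, by simp [hk]⟩)
    by_cases hak : a k = 0
    · simpa [hak] using hx0 k
    · have h1 := hmin k hak
      have h2 : (0 : ℝ) < a k := by positivity
      rw [le_div_iff₀ h2] at h1
      linarith

lemma notMem_range_update {v : Fin 3 → V} (hv : LinearIndependent ℝ v) {r : ℕ} {a : Fin 3 → ℕ}
    (ha : ∀ j, a j < r) {k : Fin 3} :
    v k ∉ Set.range (Function.update v k (okaCenter v r a)) := by
  rintro ⟨m, hm⟩
  have hr : (0 : ℝ) < r := by exact_mod_cast (Nat.zero_le _).trans_lt (ha k)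
  by_cases hmk : m = k
  · subst hmk
    rw [Function.update_self] at hm
    have := congrArg ((tripleBasis v hv).coord m) hm
    rw [coord_okaCenter, coord_self, if_pos rfl, div_eq_one_iff_eq hr.ne'] at this
    exact (ha m).ne (by exact_mod_cast this)
  · rw [Function.update_of_ne hmk] at hm
    exact hmk (hv.injective hm)

/-- Two cones of the star subdivision meet along the cone generated by the center and the
remaining generator. -/
lemma faceToFace_update {v : Fin 3 → V} (hv : LinearIndependent ℝ v) {r : ℕ} {a : Fin 3 → ℕ}
    (ha : ∀ j, a j < r) {j k : Fin 3} (hjk : j ≠ k) (hj : a j ≠ 0) (hk : a k ≠ 0) :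
    FaceToFace (Set.range (Function.update v j (okaCenter v r a)))
      (Set.range (Function.update v k (okaCenter v r a))) := by
  intro w w' hw hw' hs hs' e
  have hr : (0 : ℝ) < r := by exact_mod_cast (Nat.zero_le _).trans_lt (ha k)
  set c := okaCenter v r a with hc
  have hcj : ∀ m, (tripleBasis v hv).coord m c = (a m : ℝ) / r := coord_okaCenter hv r a
  have haj : (0 : ℝ) < (a j : ℝ) / r := by positivity
  have hak : (0 : ℝ) < (a k : ℝ) / r := by positivity
  have hij := (linearIndependent_update hv (c := c) (j := j) (by rw [hcj]; exact haj.ne')).injective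
  have hik := (linearIndependent_update hv (c := c) (j := k) (by rw [hcj]; exact hak.ne')).injective
  rw [comb_eq_sum hij hs, comb_eq_sum hik hs'] at e
  have key : ∀ m, _ := fun m => congrArg ((tripleBasis v hv).coord m) e
  simp only [coord_sum_update hv, hcj, Function.update_self] at key
  have k1 := key j
  have k2 := key k
  rw [if_pos rfl, if_neg hjk.symm, Function.update_self, Function.update_of_ne hjk] at k1
  rw [if_pos rfl, if_neg hjk, Function.update_self, Function.update_of_ne hjk.symm] at k2
  have n1 := hw (v k)
  have n2 := hw' (v j)
  have e1 : w c = w' c := by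
    apply le_antisymm
    · have : w c * ((a k : ℝ) / r) ≤ w' c * ((a k : ℝ) / r) := by linarith
      exact le_of_mul_le_mul_right this hak
    · have : w' c * ((a j : ℝ) / r) ≤ w c * ((a j : ℝ) / r) := by linarith
      exact le_of_mul_le_mul_right this haj
  rw [e1] at k1 k2
  have e2 : w' (v j) = 0 := by linarith
  have e3 : w (v k) = 0 := by linarith
  have z1 : w (v j) = 0 :=
    Finsupp.notMem_support_iff.1 fun h => notMem_range_update hv ha (hs h)
  have z2 : w' (v k) = 0 :=
    Finsupp.notMem_support_iff.1 fun h => notMem_range_update hv ha (hs' h)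
  have hall : ∀ m, w (v m) = w' (v m) := by
    intro m
    by_cases hmj : m = j
    · rw [hmj, z1, e2]
    by_cases hmk : m = k
    · rw [hmk, z2, e3]
    have := key m
    rw [if_neg (Ne.symm hmj), if_neg (Ne.symm hmk), Function.update_of_ne hmj,
      Function.update_of_ne hmk, e1] at this
    linarith
  ext y
  by_cases hy : y = c
  · rw [hy, e1]
  by_cases hy' : y ∈ Set.range v
  · obtain ⟨m, rfl⟩ := hy'
    exact hall m
  · have hn : ∀ l, y ∉ Set.range (Function.update v l c) := by
      rintro l ⟨m, rfl⟩
      by_cases hm : m = l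
      · subst hm; simp at hy
      · rw [Function.update_of_ne hm] at hy'
        exact hy' ⟨m, rfl⟩
    rw [Finsupp.notMem_support_iff.1 fun h => hn j (hs h),
      Finsupp.notMem_support_iff.1 fun h => hn k (hs' h)]

/-- If the algorithm only produces irreducible elements of the lattice, its output is a
triangulation of the cone into cones over lattice bases. -/
theorem FujikiOka.triangulation {N : AddSubgroup V} {i : Fin 3} {v : Fin 3 → V}
    {T : Set (Fin 3 → V)} (h : FujikiOka N i v T) (hv : LinearIndependent ℝ v)
    (hT : ∀ t ∈ T, ∀ j, t j ∈ hilbertBasis N orthant) :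
    T.Finite ∧ (∀ t ∈ T, IsHilbertTriple N t) ∧
      ⋃ t ∈ T, (PointedCone.hull ℝ (Set.range t) : Set V) = PointedCone.hull ℝ (Set.range v) ∧
      ∀ t ∈ T, ∀ t' ∈ T, FaceToFace (Set.range t) (Set.range t') := by
  induction h with
  | smooth v hN =>
    refine ⟨Set.finite_singleton _, ?_, by simp, ?_⟩
    · rintro t rfl
      exact ⟨hv, hN, hT t rfl⟩
    · rintro t rfl t' rfl
      exact faceToFace_self hv
  | blowup v r a hr hi ha hN T hTj ih =>
    have hr0 : (0 : ℝ) < r := by positivity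
    have hmem : ∀ j, a j ≠ 0 → ∀ t ∈ T j, t ∈ ⋃ j, ⋃ (_ : a j ≠ 0), T j := fun j hj t ht =>
      Set.mem_iUnion₂.2 ⟨j, hj, ht⟩
    have hind : ∀ j, a j ≠ 0 → LinearIndependent ℝ (Function.update v j (okaCenter v r a)) :=
      fun j hj => linearIndependent_update hv (by rw [coord_okaCenter]; positivity)
    have ih' := fun j hj => ih j hj (hind j hj) fun t ht => hT t (hmem j hj t ht)
    have hHT : ∀ t ∈ ⋃ j, ⋃ (_ : a j ≠ 0), T j, IsHilbertTriple N t := by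
      intro t ht
      obtain ⟨j, hj, ht⟩ := Set.mem_iUnion₂.1 ht
      exact (ih' j hj).2.1 t ht
    have hin : ∀ j, a j ≠ 0 → ∀ t ∈ T j, ∀ m,
        t m ∈ PointedCone.hull ℝ (Set.range (Function.update v j (okaCenter v r a))) := by
      intro j hj t ht m
      rw [← SetLike.mem_coe, ← (ih' j hj).2.2.1]
      exact Set.mem_biUnion ht (PointedCone.subset_hull (Set.mem_range_self m))
    refine ⟨Set.finite_iUnion fun j => Set.finite_iUnion fun hj => (ih' j hj).1, hHT, ?_, ?_⟩
    · apply Set.Subset.antisymm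
      · refine Set.iUnion₂_subset fun t ht => ?_
        obtain ⟨j, hj, ht⟩ := Set.mem_iUnion₂.1 ht
        exact (hull_le (hin j hj t ht)).trans (hull_update_le r a j)
      · intro x hx
        obtain ⟨j, hj, hxj⟩ := exists_mem_hull_update hr (a := a) (i := i) (by omega) hx
        rw [← SetLike.mem_coe, ← (ih' j hj).2.2.1] at hxj
        obtain ⟨t, ht, hxt⟩ := Set.mem_iUnion₂.1 hxj
        exact Set.mem_iUnion₂.2 ⟨t, hmem j hj t ht, hxt⟩
    · intro t ht t' ht'
      obtain ⟨j, hj, htj⟩ := Set.mem_iUnion₂.1 ht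
      obtain ⟨k, hk, htk⟩ := Set.mem_iUnion₂.1 ht'
      by_cases hjk : j = k
      · subst hjk
        exact (ih' j hj).2.2.2 t htj t' htk
      · refine faceToFace_of_parts (hind j hj) (hind k hk) (faceToFace_update hv ha hjk hj hk)
          (k := k) ?_ (hin j hj t htj) (hin k hk t' htk) (hHT t ht) (hHT t' ht')
        rw [Function.update_of_ne (Ne.symm hjk)]
        exact notMem_range_update hv ha

/-! ### Hilbert desingularizations from Hilbert triples -/

/-- The `ℤ`-basis of the lattice given by a Hilbert triple. -/
noncomputable def IsHilbertTriple.basis {N : AddSubgroup V} {t : Fin 3 → V}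
    (h : IsHilbertTriple N t) : Module.Basis (Fin 3) ℤ N :=
  Module.Basis.mk (v := fun j => (⟨t j, (h.mem j).2.1⟩ : N))
    (LinearIndependent.of_comp N.subtype.toIntLinearMap
      (h.linInd.restrict_scalars (R := ℤ) (by
        intro a b hab
        simpa using hab)))
    (by
      rintro ⟨x, hx⟩ -
      have hx' := hx
      rw [h.closure, mem_closure_range] at hx'
      obtain ⟨n, hn⟩ := hx'
      rw [Submodule.mem_span_range_iff_exists_fun]
      refine ⟨n, Subtype.ext ?_⟩
      simp [← hn, Int.cast_smul_eq_zsmul])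

lemma IsHilbertTriple.basis_apply {N : AddSubgroup V} {t : Fin 3 → V}
    (h : IsHilbertTriple N t) (j : Fin 3) : (h.basis j : V) = t j := by
  simp [IsHilbertTriple.basis]

/-- A face-to-face family of Hilbert triples whose cones cover the orthant is a Hilbert
desingularization. -/
theorem isHilbertDesingularization_fanOf {N : AddSubgroup V} {T : Set (Fin 3 → V)}
    (hfin : T.Finite) (hH : ∀ t ∈ T, IsHilbertTriple N t)
    (hF : ∀ t ∈ T, ∀ t' ∈ T, FaceToFace (Set.range t) (Set.range t'))
    (hU : ⋃ t ∈ T, (PointedCone.hull ℝ (Set.range t) : Set V) = (orthant : Set V)) :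
    IsHilbertDesingularization N orthant (fanOf T) := by
  refine ⟨⟨isFan_fanOf hfin (fun t ht j => ((hH t ht).mem j).1)
    (fun t ht j => ((hH t ht).mem j).2.1) hF, ?_⟩, ?_, ?_⟩
  · rw [iUnion_fanOf, hU]
  · rintro τ ⟨t, ht, h⟩
    refine ⟨(hH t ht).basis, {j | t j ∈ τ}, ?_⟩
    simp only [IsHilbertTriple.basis_apply]
    exact face_eq_hull h
  · ext x
    constructor
    · rintro ⟨⟨hxN, hx0, hprim⟩, t, ht, hface⟩
      have h := hH t ht
      have hx : x ∈ PointedCone.hull ℝ (Set.range t) :=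
        hface.le (PointedCone.subset_hull rfl)
      have hxN' := hxN
      rw [h.closure, mem_closure_range] at hxN'
      obtain ⟨n, hn⟩ := hxN'
      have hcoord : ∀ j, (tripleBasis t h.linInd).coord j x = n j := fun j => by
        rw [← hn, coord_sum t h.linInd (fun j => (n j : ℝ))]
      have hnn : ∀ j, (0 : ℝ) ≤ n j := fun j => by
        rw [← hcoord]; exact (mem_hull_iff_coord h.linInd).1 hx j
      obtain ⟨j, hj⟩ : ∃ j, n j ≠ 0 := by
        by_contra! hall
        exact hx0 (by simp [← hn, hall])
      have hj0 : (0 : ℝ) < n j := (hnn j).lt_of_ne (by exact_mod_cast hj.symm)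
      have hmem : t j ∈ PointedCone.hull ℝ {x} :=
        hface.mem_of_sum_smul_mem (fun j => PointedCone.subset_hull (Set.mem_range_self j)) hnn
          (hn ▸ PointedCone.subset_hull rfl) j hj0
      -- `t j` is a multiple of the primitive vector `x`, and conversely
      obtain ⟨⟨l, hl0⟩, hl⟩ := Submodule.mem_span_singleton.1 hmem
      replace hl : l • x = t j := hl
      have h1 : l * n j = 1 := by
        have := congrArg ((tripleBasis t h.linInd).coord j) hl
        rwa [map_smul, hcoord, coord_self, if_pos rfl, smul_eq_mul] at this
      have hlpos : 0 < l := by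
        rcases hl0.eq_or_lt with h | h
        · rw [← h, zero_mul] at h1; exact absurd h1 (by norm_num)
        · exact h
      have hl1 : ¬ l < 1 := fun hlt => hprim l hlpos hlt (hl ▸ (h.mem j).2.1)
      have hn1 : (1 : ℝ) ≤ n j := by
        exact_mod_cast Int.add_one_le_iff.2 (by exact_mod_cast hj0 : (0 : ℤ) < n j)
      have : l = 1 := by
        apply le_antisymm _ (not_lt.1 hl1)
        by_contra! hgt
        nlinarith
      rw [this, one_smul] at hl
      rw [hl]
      exact h.mem j
    · intro hx
      have hx' := hx.1
      rw [← SetLike.mem_coe, ← hU] at hx'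
      obtain ⟨t, ht, hxt⟩ := Set.mem_iUnion₂.1 hx'
      have h := hH t ht
      obtain ⟨j, rfl⟩ := h.eq_of_mem_hull hx hxt
      refine ⟨⟨hx.2.1, hx.2.2.1, fun s hs0 hs1 hs => ?_⟩, t, ht, ?_, ?_⟩
      · rw [h.closure, mem_closure_range] at hs
        obtain ⟨n, hn⟩ := hs
        have := congrArg ((tripleBasis t h.linInd).coord j) hn
        rw [coord_sum t h.linInd (fun j => (n j : ℝ)), map_smul, coord_self, if_pos rfl,
          smul_eq_mul, mul_one] at this
        rw [← this] at hs0 hs1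
        have h1 : (0 : ℤ) < n j := by exact_mod_cast hs0
        have h2 : n j < (1 : ℤ) := by exact_mod_cast hs1
        omega
      · exact Submodule.span_mono (by rintro _ rfl; exact Set.mem_range_self j)
      · intro y z a hy hz ha hyz
        obtain ⟨⟨l, hl0⟩, hl⟩ := Submodule.mem_span_singleton.1 hyz
        replace hl : l • t j = a • y + z := hl
        rw [mem_hull_iff_coord h.linInd] at hy hz
        have hk : ∀ k, k ≠ j → (tripleBasis t h.linInd).coord k y = 0 := by
          intro k hk
          have := congrArg ((tripleBasis t h.linInd).coord k) hl
          rw [map_smul, coord_self, if_neg hk.symm, smul_zero, map_add, map_smul,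
            smul_eq_mul] at this
          have h1 := hy k
          have h2 := hz k
          by_contra hne
          have := mul_pos ha (h1.lt_of_ne (Ne.symm hne))
          linarith
        have e := sum_coord_smul t h.linInd y
        rw [Finset.sum_eq_single j (fun k _ hkj => by rw [hk k hkj, zero_smul]) (by simp)] at e
        rw [← e]
        exact PointedCone.smul_mem _ (hy j) (PointedCone.subset_hull rfl)

/-! ### Running the Fujiki–Oka algorithm -/

/-- The cone with generators `v` is semi-unimodular over `v i` of index `r`: `L` is generated by `v`
and a vector `(1/r) ∑ a j v j` with `a i = 1`. The integers `a j` need not be reduced modulo `r`,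
and `r = 1` means that the cone is smooth. -/
def IsSemiUnimodular (L : AddSubgroup V) (v : Fin 3 → V) (i : Fin 3) (r : ℕ) : Prop :=
  0 < r ∧ ∃ a : Fin 3 → ℤ, a i = 1 ∧
    L = AddSubgroup.closure (Set.range v ∪ {∑ j, ((a j : ℝ) / r) • v j})

lemma closure_union_singleton_congr {S S' : Set V} {x y : V}
    (h1 : ∀ s ∈ S, s ∈ AddSubgroup.closure (S' ∪ {y})) (h2 : x ∈ AddSubgroup.closure (S' ∪ {y}))
    (h3 : ∀ s ∈ S', s ∈ AddSubgroup.closure (S ∪ {x})) (h4 : y ∈ AddSubgroup.closure (S ∪ {x})) :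
    AddSubgroup.closure (S ∪ {x}) = AddSubgroup.closure (S' ∪ {y}) := by
  apply le_antisymm
  · rw [AddSubgroup.closure_le]
    rintro s (hs | rfl)
    exacts [h1 s hs, h2]
  · rw [AddSubgroup.closure_le]
    rintro s (hs | rfl)
    exacts [h3 s hs, h4]

lemma mem_closure_left {S : Set V} {x s : V} (hs : s ∈ S) : s ∈ AddSubgroup.closure (S ∪ {x}) :=
  AddSubgroup.subset_closure (.inl hs)

lemma mem_closure_right {S : Set V} {x : V} : x ∈ AddSubgroup.closure (S ∪ {x}) :=
  AddSubgroup.subset_closure (.inr rfl)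

lemma int_smul_mem {L : AddSubgroup V} {x : V} (hx : x ∈ L) (n : ℤ) : (n : ℝ) • x ∈ L := by
  rw [Int.cast_smul_eq_zsmul]; exact L.zsmul_mem hx n

lemma nat_smul_mem {L : AddSubgroup V} {x : V} (hx : x ∈ L) (n : ℕ) : (n : ℝ) • x ∈ L := by
  exact_mod_cast int_smul_mem hx (n : ℤ)

lemma sum_int_smul_mem {L : AddSubgroup V} {v : Fin 3 → V} (hv : ∀ j, v j ∈ L) (n : Fin 3 → ℤ) :
    ∑ j, (n j : ℝ) • v j ∈ L :=
  L.sum_mem fun j _ => int_smul_mem (hv j) _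

lemma mem_closure_range_union {v : Fin 3 → V} {c y : V} :
    y ∈ AddSubgroup.closure (Set.range v ∪ {c}) ↔
      ∃ (n : Fin 3 → ℤ) (m : ℤ), ∑ j, (n j : ℝ) • v j + (m : ℝ) • c = y := by
  rw [AddSubgroup.closure_union, AddSubgroup.mem_sup]
  simp only [mem_closure_range, AddSubgroup.mem_closure_singleton]
  constructor
  · rintro ⟨_, ⟨n, rfl⟩, _, ⟨m, rfl⟩, rfl⟩
    exact ⟨n, m, by rw [Int.cast_smul_eq_zsmul]⟩
  · rintro ⟨n, m, rfl⟩
    exact ⟨_, ⟨n, rfl⟩, _, ⟨m, rfl⟩, by rw [Int.cast_smul_eq_zsmul]⟩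

lemma IsSemiUnimodular.eq_closure_of_one {L : AddSubgroup V} {v : Fin 3 → V} {i : Fin 3}
    (h : IsSemiUnimodular L v i 1) : L = AddSubgroup.closure (Set.range v) := by
  obtain ⟨-, a, -, hL⟩ := h
  rw [hL]
  apply le_antisymm
  · rw [AddSubgroup.closure_le]
    rintro s (hs | rfl)
    · exact AddSubgroup.subset_closure hs
    · exact mem_closure_range.2 ⟨a, by simp⟩
  · exact AddSubgroup.closure_mono Set.subset_union_left

/-- Reducing the coefficients of a rational combination modulo `r` changes it by an integral
combination. -/
lemma sum_eq_okaCenter_add {v : Fin 3 → V} {r : ℕ} (hr : 0 < r) {A : Fin 3 → ℤ} {a : Fin 3 → ℕ}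
    (ha : ∀ j, (a j : ℤ) = A j % r) :
    ∑ j, ((A j : ℝ) / r) • v j = okaCenter v r a + ∑ j, ((A j / r : ℤ) : ℝ) • v j := by
  rw [okaCenter, ← Finset.sum_add_distrib]
  refine Finset.sum_congr rfl fun j _ => ?_
  rw [← add_smul]
  congr 1
  have h2 : (a j : ℝ) + r * ((A j / r : ℤ) : ℝ) = A j := by
    have := Int.emod_add_mul_ediv (A j) r
    rw [← ha j] at this
    exact_mod_cast this
  have hr' : (r : ℝ) ≠ 0 := by positivity
  field_simp
  linarith

lemma exists_nat_emod {r : ℕ} (hr : 0 < r) (A : Fin 3 → ℤ) :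
    ∃ a : Fin 3 → ℕ, (∀ j, (a j : ℤ) = A j % r) ∧ ∀ j, a j < r := by
  have hr0 : (0 : ℤ) < r := by positivity
  have h : ∀ j, (((A j % r).toNat : ℕ) : ℤ) = A j % r := fun j =>
    Int.toNat_of_nonneg (Int.emod_nonneg _ hr0.ne')
  refine ⟨fun j => (A j % r).toNat, h, fun j => ?_⟩
  have := Int.emod_lt_of_pos (A j) hr0
  have := h j
  dsimp only
  omega

/-- The center can be moved into the half-open box spanned by the generators. -/
lemma IsSemiUnimodular.exists_okaCenter {L : AddSubgroup V} {v : Fin 3 → V} {i : Fin 3} {r : ℕ}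
    (h : IsSemiUnimodular L v i r) (hr : 1 < r) : ∃ a : Fin 3 → ℕ, a i = 1 ∧ (∀ j, a j < r) ∧
      L = AddSubgroup.closure (Set.range v ∪ {okaCenter v r a}) := by
  obtain ⟨hr0, A, hi, hL⟩ := h
  obtain ⟨a, ha, har⟩ := exists_nat_emod hr0 A
  refine ⟨a, ?_, har, ?_⟩
  · have := ha i
    rw [hi, Int.emod_eq_of_lt (by norm_num) (by exact_mod_cast hr)] at this
    exact_mod_cast this
  · have e := sum_eq_okaCenter_add (v := v) hr0 ha
    rw [hL]
    have hsum : ∀ x : V, ∑ j, ((A j / r : ℤ) : ℝ) • v j ∈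
        AddSubgroup.closure (Set.range v ∪ {x}) := fun x =>
      sum_int_smul_mem (fun j => mem_closure_left (Set.mem_range_self j)) _
    refine closure_union_singleton_congr (fun s hs => mem_closure_left hs) ?_
      (fun s hs => mem_closure_left hs) ?_
    · rw [e]
      exact AddSubgroup.add_mem _ mem_closure_right (hsum _)
    · rw [← sub_eq_iff_eq_add] at e
      rw [← e]
      exact AddSubgroup.sub_mem _ mem_closure_right (hsum _)

lemma smul_okaCenter {v : Fin 3 → V} {r : ℕ} (hr : 0 < r) (a : Fin 3 → ℕ) (j : Fin 3) :
    (r : ℝ) • okaCenter v r a =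
      (a j : ℝ) • v j + ∑ k ∈ Finset.univ.erase j, (a k : ℝ) • v k := by
  rw [Finset.add_sum_erase _ (fun k => (a k : ℝ) • v k) (Finset.mem_univ j), okaCenter,
    Finset.smul_sum]
  refine Finset.sum_congr rfl fun k _ => ?_
  have : (r : ℝ) ≠ 0 := by positivity
  rw [smul_smul, mul_div_cancel₀ _ this]

lemma sum_erase_mem_closure_update {v : Fin 3 → V} (c : V) (a : Fin 3 → ℕ) (j : Fin 3) :
    ∑ k ∈ Finset.univ.erase j, (a k : ℝ) • v k ∈
      AddSubgroup.closure (Set.range (Function.update v j c)) :=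
  AddSubgroup.sum_mem _ fun k hk => nat_smul_mem (AddSubgroup.subset_closure (Set.mem_range.2
    ⟨k, by rw [Function.update_of_ne (Finset.ne_of_mem_erase hk)]⟩)) _

lemma center_mem_closure_update {v : Fin 3 → V} (c : V) (j : Fin 3) :
    c ∈ AddSubgroup.closure (Set.range (Function.update v j c)) :=
  AddSubgroup.subset_closure ⟨j, by simp⟩

/-- The cone in which the generator of coefficient `1 / r` is replaced by the center is smooth. -/
lemma closure_update_center {L : AddSubgroup V} {v : Fin 3 → V} {i : Fin 3} {r : ℕ} (hr : 0 < r)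
    {a : Fin 3 → ℕ} (hi : a i = 1)
    (hL : L = AddSubgroup.closure (Set.range v ∪ {okaCenter v r a})) :
    L = AddSubgroup.closure (Set.range (Function.update v i (okaCenter v r a))) := by
  rw [hL]
  have hc := center_mem_closure_update (v := v) (okaCenter v r a) i
  apply le_antisymm
  · rw [AddSubgroup.closure_le]
    rintro s (⟨k, rfl⟩ | rfl)
    · by_cases hk : k = i
      · subst hk
        have e := smul_okaCenter (v := v) hr a k
        rw [hi, Nat.cast_one, one_smul, ← sub_eq_iff_eq_add] at e
        rw [← e]
        exact AddSubgroup.sub_mem _ (nat_smul_mem hc r) (sum_erase_mem_closure_update _ a k)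
      · exact AddSubgroup.subset_closure ⟨k, by rw [Function.update_of_ne hk]⟩
    · exact hc
  · rw [AddSubgroup.closure_le]
    rintro _ ⟨k, rfl⟩
    by_cases hk : k = i
    · subst hk; rw [Function.update_self]; exact mem_closure_right
    · rw [Function.update_of_ne hk]; exact mem_closure_left (Set.mem_range_self k)

/-- The cone in which `v j`, with `j ≠ i`, is replaced by the center is semi-unimodular over `v i`
of index `a j`. Its center is `-v j`. -/
lemma isSemiUnimodular_update {L : AddSubgroup V} {v : Fin 3 → V} {i j : Fin 3} {r : ℕ}
    (hr : 0 < r) {a : Fin 3 → ℕ} (hi : a i = 1) (hj : a j ≠ 0) (hji : j ≠ i)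
    (hL : L = AddSubgroup.closure (Set.range v ∪ {okaCenter v r a})) :
    IsSemiUnimodular L (Function.update v j (okaCenter v r a)) i (a j) := by
  refine ⟨Nat.pos_of_ne_zero hj, fun k => if k = j then -r else a k, ?_, ?_⟩
  · simp [hji.symm, hi]
  · have hj' : (a j : ℝ) ≠ 0 := by exact_mod_cast hj
    have e : ∑ k, (((if k = j then -(r : ℤ) else a k : ℤ) : ℝ) / a j) •
        Function.update v j (okaCenter v r a) k = -v j := by
      rw [← Finset.add_sum_erase _ _ (Finset.mem_univ j)]
      have h1 : ∑ k ∈ Finset.univ.erase j, (((if k = j then -(r : ℤ) else a k : ℤ) : ℝ) / a j) •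
          Function.update v j (okaCenter v r a) k =
          (a j : ℝ)⁻¹ • ∑ k ∈ Finset.univ.erase j, (a k : ℝ) • v k := by
        rw [Finset.smul_sum]
        refine Finset.sum_congr rfl fun k hk => ?_
        have hkj := Finset.ne_of_mem_erase hk
        rw [if_neg hkj, Function.update_of_ne hkj, smul_smul, Int.cast_natCast, div_eq_inv_mul]
      have h2 := smul_okaCenter (v := v) hr a j
      rw [h1, if_pos rfl, Function.update_self, Int.cast_neg, Int.cast_natCast, div_eq_inv_mul,
        mul_smul, neg_smul, h2, ← smul_add, neg_add_rev, add_comm, ← add_assoc, add_neg_cancel,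
        zero_add, smul_neg, smul_smul, inv_mul_cancel₀ hj', one_smul]
    rw [e, hL]
    refine closure_union_singleton_congr ?_ (mem_closure_left ⟨j, by simp⟩) ?_
      (AddSubgroup.neg_mem _ (mem_closure_left (Set.mem_range_self j)))
    · rintro _ ⟨k, rfl⟩
      by_cases hk : k = j
      · subst hk
        exact neg_mem_iff.1 mem_closure_right
      · exact mem_closure_left ⟨k, by rw [Function.update_of_ne hk]⟩
    · rintro _ ⟨k, rfl⟩
      by_cases hk : k = j
      · subst hk; rw [Function.update_self]; exact mem_closure_right
      · rw [Function.update_of_ne hk]; exact mem_closure_left (Set.mem_range_self k)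

/-- The algorithm terminates on every semi-unimodular cone. If `P` is an invariant of the cones to
which it is applied again and `Q` holds for the generators of these cones and for their centers,
then `Q` holds for all generators of the result. -/
theorem exists_fujikiOka {L : AddSubgroup V} {i : Fin 3} (P : (Fin 3 → V) → Prop) (Q : V → Prop)
    (hPQ : ∀ v, P v → ∀ j, Q (v j))
    (step : ∀ v (r : ℕ) (a : Fin 3 → ℕ), P v → 1 < r → a i = 1 → (∀ j, a j < r) →
      L = AddSubgroup.closure (Set.range v ∪ {okaCenter v r a}) → Q (okaCenter v r a) ∧
        ∀ j, j ≠ i → a j ≠ 0 → P (Function.update v j (okaCenter v r a)))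
    (r : ℕ) : ∀ v, P v → IsSemiUnimodular L v i r →
      ∃ T, FujikiOka L i v T ∧ ∀ t ∈ T, ∀ j, Q (t j) := by
  induction r using Nat.strong_induction_on with
  | _ r ih =>
    intro v hP hv
    rcases (Nat.succ_le_iff.2 hv.1).eq_or_lt with h1 | hr
    · obtain rfl : r = 1 := h1.symm
      exact ⟨{v}, .smooth v hv.eq_closure_of_one, by rintro t rfl; exact hPQ t hP⟩
    · obtain ⟨a, hi, ha, hL⟩ := hv.exists_okaCenter hr
      obtain ⟨hQ, hstep⟩ := step v r a hP hr hi ha hL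
      have hT : ∀ j, ∃ T, a j ≠ 0 → FujikiOka L i (Function.update v j (okaCenter v r a)) T ∧
          ∀ t ∈ T, ∀ j, Q (t j) := by
        intro j
        by_cases hj : a j = 0
        · exact ⟨∅, fun h => absurd hj h⟩
        by_cases hji : j = i
        · subst hji
          refine ⟨_, fun _ => ⟨.smooth _ (closure_update_center hv.1 hi hL), ?_⟩⟩
          rintro t rfl k
          by_cases hk : k = j
          · subst hk; rwa [Function.update_self]
          · rw [Function.update_of_ne hk]; exact hPQ v hP k
        · obtain ⟨T, h⟩ := ih (a j) (ha j) _ (hstep j hji hj)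
            (isSemiUnimodular_update hv.1 hi hj hji hL)
          exact ⟨T, fun _ => h⟩
      choose T hT using hT
      refine ⟨_, .blowup v r a hr hi ha hL T fun j hj => (hT j hj).1, ?_⟩
      intro t ht
      obtain ⟨j, hj, htj⟩ := Set.mem_iUnion₂.1 ht
      exact (hT j hj).2 t htj

/-! ### Crepant cones and terminal cones -/

/-- The age as a linear functional. -/
def ageHom : V →ₗ[ℝ] ℝ := ∑ i, LinearMap.proj i

lemma ageHom_apply (x : V) : ageHom x = age x := by
  simp [ageHom, age]

lemma map_okaCenter (f : V →ₗ[ℝ] ℝ) (v : Fin 3 → V) (r : ℕ) (a : Fin 3 → ℕ) :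
    f (okaCenter v r a) = ∑ j, (a j : ℝ) / r * f (v j) := by
  simp [okaCenter, map_sum]

lemma exists_sum_eq (i : Fin 3) : ∃ j k : Fin 3, j ≠ i ∧ k ≠ i ∧
    ∀ f : Fin 3 → ℝ, ∑ l, f l = f i + f j + f k := by
  fin_cases i
  · exact ⟨1, 2, by decide, by decide, fun f => by simp [Fin.sum_univ_three]⟩
  · exact ⟨0, 2, by decide, by decide, fun f => by simp [Fin.sum_univ_three]; ring⟩
  · exact ⟨0, 1, by decide, by decide, fun f => by simp [Fin.sum_univ_three]; ring⟩

lemma okaCenter_mem_orthant {v : Fin 3 → V} (hv : ∀ j, v j ∈ orthant) (r : ℕ) (a : Fin 3 → ℕ) :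
    okaCenter v r a ∈ orthant :=
  hull_le hv (okaCenter_mem_hull r a)

/-- If all ages are integral, every center of a cone generated by vectors of age `1` has age `1`,
since its age is less than `2`. -/
theorem exists_fujikiOka_of_integral {L : AddSubgroup V} {v : Fin 3 → V} {i : Fin 3} {r : ℕ}
    (hint : ∀ x ∈ L, ∃ n : ℤ, age x = n)
    (hv : ∀ j, v j ∈ L ∧ v j ∈ orthant ∧ age (v j) = 1) (hsu : IsSemiUnimodular L v i r) :
    ∃ T, FujikiOka L i v T ∧ ∀ t ∈ T, ∀ j, t j ∈ L ∧ t j ∈ orthant ∧ age (t j) = 1 := by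
  refine exists_fujikiOka (fun v => ∀ j, v j ∈ L ∧ v j ∈ orthant ∧ age (v j) = 1)
    (fun x => x ∈ L ∧ x ∈ orthant ∧ age x = 1) (fun v hv => hv) ?_ r v hv hsu
  intro v r a hv hr hi ha hL
  have hr0 : (0 : ℝ) < r := by positivity
  have hcL : okaCenter v r a ∈ L := hL ▸ mem_closure_right
  have hage : age (okaCenter v r a) = ∑ j, (a j : ℝ) / r := by
    rw [← ageHom_apply, map_okaCenter]
    simp only [ageHom_apply, (hv _).2.2, mul_one]
  have hc : okaCenter v r a ∈ L ∧ okaCenter v r a ∈ orthant ∧ age (okaCenter v r a) = 1 := by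
    refine ⟨hcL, okaCenter_mem_orthant (fun j => (hv j).2.1) r a, ?_⟩
    obtain ⟨n, hn⟩ := hint _ hcL
    obtain ⟨j, k, -, -, hs⟩ := exists_sum_eq i
    rw [hs, hi] at hage
    have hbound : ∀ j, (a j : ℝ) + 1 ≤ r := fun j => by exact_mod_cast ha j
    have h1 : age (okaCenter v r a) < 2 := by
      rw [hage, ← add_div, ← add_div, div_lt_iff₀ hr0]
      have := hbound j; have := hbound k
      push_cast
      linarith
    have h2 : 0 < age (okaCenter v r a) := by
      rw [hage]; push_cast; positivity
    rw [hn] at h1 h2 ⊢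
    have h1' : n < 2 := by exact_mod_cast h1
    have h2' : 0 < n := by exact_mod_cast h2
    obtain rfl : n = 1 := by omega
    norm_num
  refine ⟨hc, fun j _ _ k => ?_⟩
  by_cases hk : k = j
  · subst hk; rwa [Function.update_self]
  · rw [Function.update_of_ne hk]; exact hv k

/-- The invariant of the cones `v` into which the algorithm divides a terminal cone `t` over its
generator `t i`, where `f` is the sum of the two other coordinates on the cone `t`: the generators
other than `t i` lie at height `f = 1` and have age less than `2`, and no point of `L` at height `1`
in the cone `t` lies below the face of `v` opposite to `t i`. -/
structure IsEconomic (L : AddSubgroup V) (t : Fin 3 → V) (i : Fin 3) (f : V →ₗ[ℝ] ℝ)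
    (v : Fin 3 → V) : Prop where
  linInd : LinearIndependent ℝ v
  self : v i = t i
  mem : ∀ k, k ≠ i → v k ∈ L ∧ v k ∈ PointedCone.hull ℝ (Set.range t) ∧ f (v k) = 1 ∧ age (v k) < 2
  above : ∀ p ∈ L, p ∈ PointedCone.hull ℝ (Set.range t) → f p = 1 → ∀ d : Fin 3 → ℝ,
    p = ∑ k, d k • v k → (∀ k, k ≠ i → 0 ≤ d k) → 0 ≤ d i

/-- A cone `t` of age `1` generators in which the sum of the coordinates other than the `i`-th one
is integral on the lattice is a terminal cone of type `1/r (1, -1, b)`. Every center at height `1`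
has age less than `2`: otherwise, subtracting `t i` gives a lattice point below the cone. -/
theorem exists_fujikiOka_of_terminal {L : AddSubgroup V} {t : Fin 3 → V} {i : Fin 3} {r : ℕ}
    (hcan : IsCanonical L) (ht : LinearIndependent ℝ t)
    (htL : ∀ j, t j ∈ L ∧ t j ∈ orthant ∧ age (t j) = 1)
    (hint : ∀ x ∈ L, ∃ n : ℤ, age x - (tripleBasis t ht).coord i x = n)
    (hsu : IsSemiUnimodular L t i r) :
    ∃ T, FujikiOka L i t T ∧ ∀ t' ∈ T, ∀ j, t' j ∈ hilbertBasis L orthant := by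
  set φ := (tripleBasis t ht).coord with hφ
  set f : V →ₗ[ℝ] ℝ := ageHom - φ i with hf
  have hfx : ∀ x, f x = age x - φ i x := fun x => by
    rw [hf, LinearMap.sub_apply, ageHom_apply]
  have hsub : PointedCone.hull ℝ (Set.range t) ≤ orthant := hull_le fun j => (htL j).2.1
  have hti0 : ∀ j, t j ≠ 0 := fun j h => by
    have := (htL j).2.2
    rw [h] at this
    simp [age] at this
  have hself : ∀ v, IsEconomic L t i f v → v i ∈ hilbertBasis L orthant := by
    intro v hv
    rw [hv.self]
    exact mem_hilbertBasis_of_age_lt hcan (htL i).1 (htL i).2.1 (hti0 i)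
      (by rw [(htL i).2.2]; norm_num)
  refine exists_fujikiOka (IsEconomic L t i f) (fun x => x ∈ hilbertBasis L orthant)
    ?_ ?_ r t ?_ hsu
  · intro v hv j
    by_cases hj : j = i
    · subst hj; exact hself v hv
    · obtain ⟨h1, h2, h3, h4⟩ := hv.mem j hj
      exact mem_hilbertBasis_of_age_lt hcan h1 (hsub h2) (hv.linInd.ne_zero j) h4
  · intro v r a hv hr hi ha hL
    have hr0 : (0 : ℝ) < r := by positivity
    obtain ⟨j, k, hji, hki, hs⟩ := exists_sum_eq i
    set c := okaCenter v r a with hc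
    have hcL : c ∈ L := hL ▸ mem_closure_right
    have hvt : ∀ l, v l ∈ PointedCone.hull ℝ (Set.range t) := fun l => by
      by_cases hl : l = i
      · rw [hl, hv.self]; exact PointedCone.subset_hull (Set.mem_range_self i)
      · exact (hv.mem l hl).2.1
    have hct : c ∈ PointedCone.hull ℝ (Set.range t) := hull_le hvt (okaCenter_mem_hull r a)
    have hfi : f (v i) = 0 := by
      rw [hfx, hv.self, (htL i).2.2, hφ, coord_self, if_pos rfl, sub_self]
    have hfc : f c = (a j : ℝ) / r + (a k : ℝ) / r := by
      rw [hc, map_okaCenter, hs, hfi, (hv.mem j hji).2.2.1, (hv.mem k hki).2.2.1]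
      ring
    -- the height of the center is a positive integer less than `2`
    have hf1 : f c = 1 := by
      obtain ⟨n, hn⟩ := hint c hcL
      rw [← hfx] at hn
      have hbound : ∀ j, (a j : ℝ) + 1 ≤ r := fun j => by exact_mod_cast ha j
      have h1 : f c < 2 := by
        rw [hfc, ← add_div, div_lt_iff₀ hr0]
        have := hbound j; have := hbound k
        linarith
      have h2 : 0 < f c := by
        have h0 : 0 ≤ f c := by rw [hfc]; positivity
        refine h0.lt_of_ne fun h0 => ?_
        rw [hfc] at h0
        have e1 : (a j : ℝ) / r = 0 := by
          have : (0 : ℝ) ≤ (a j : ℝ) / r := by positivity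
          have : (0 : ℝ) ≤ (a k : ℝ) / r := by positivity
          linarith
        have e2 : (a k : ℝ) / r = 0 := by linarith
        have hage : age c = 1 / r := by
          rw [← ageHom_apply, hc, map_okaCenter, hs, e1, e2, ageHom_apply, hv.self,
            (htL i).2.2, hi]
          simp
        have hc0 : c ≠ 0 := by
          intro h
          rw [h] at hage
          have h1 : (0 : ℝ) < 1 / r := by positivity
          have h2 : age (0 : V) = 0 := by simp [age]
          linarith
        have := hcan c hcL (hsub hct) hc0
        rw [hage, le_div_iff₀ hr0, one_mul] at this
        have : r ≤ 1 := by exact_mod_cast this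
        omega
      rw [hn] at h1 h2 ⊢
      have h1' : n < 2 := by exact_mod_cast h1
      have h2' : 0 < n := by exact_mod_cast h2
      obtain rfl : n = 1 := by omega
      norm_num
    have hcage : age c < 2 := by
      by_contra! hge
      have hz : 1 ≤ φ i c := by have := hfx c; linarith
      have hmem : c - t i ∈ PointedCone.hull ℝ (Set.range t) := by
        rw [mem_hull_iff_coord ht]
        intro l
        rw [map_sub, coord_self]
        have := (mem_hull_iff_coord ht).1 hct l
        split_ifs with h
        · subst h; exact sub_nonneg.2 hz
        · simpa using this
      have hfci : f (c - t i) = 1 := by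
        rw [map_sub, hf1, ← hv.self, hfi, sub_zero]
      have := hv.above (c - t i) (L.sub_mem hcL (htL i).1) hmem hfci
        (fun l => (a l : ℝ) / r - if l = i then 1 else 0) (by
          rw [← hv.self]
          simp [sub_smul, Finset.sum_sub_distrib, hc, okaCenter]) (fun l hl => by
          simp only [if_neg hl, sub_zero]; positivity)
      simp only [if_pos, hi, Nat.cast_one] at this
      have h1r : (1 : ℝ) / r < 1 := by
        rw [div_lt_one hr0]; exact_mod_cast hr
      linarith
    have hc0 : c ≠ 0 := fun h => by rw [h, map_zero] at hf1; exact zero_ne_one hf1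
    refine ⟨mem_hilbertBasis_of_age_lt hcan hcL (hsub hct) hc0 hcage, ?_⟩
    intro j hji haj
    have haj' : (0 : ℝ) < (a j : ℝ) / r := by positivity
    refine ⟨linearIndependent_update hv.linInd (by rw [coord_okaCenter]; exact haj'.ne'),
      by rw [Function.update_of_ne hji.symm, hv.self], ?_, ?_⟩
    · intro k hk
      by_cases hkj : k = j
      · subst hkj
        rw [Function.update_self]
        exact ⟨hcL, hct, hf1, hcage⟩
      · rw [Function.update_of_ne hkj]
        exact hv.mem k hk
    · intro p hp hpt hfp d hd hdnn
      -- compare the coordinates of `p` in the cone `v` with those given by `p ∈ L`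
      have hcoord : ∀ l, (tripleBasis v hv.linInd).coord l p =
          d l + d j * ((a l : ℝ) / r - if j = l then 1 else 0) := fun l => by
        rw [hd, coord_sum_update hv.linInd, coord_okaCenter]
      obtain ⟨n, m, hnm⟩ := mem_closure_range_union.1 (hL ▸ hp)
      have hcoord' : ∀ l, (tripleBasis v hv.linInd).coord l p = n l + m * ((a l : ℝ) / r) :=
        fun l => by
          rw [← hnm, map_add, coord_sum v hv.linInd (fun j => (n j : ℝ)), map_smul,
            coord_okaCenter, smul_eq_mul]
      have hi1 := hcoord i
      have hi2 := hcoord' i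
      have hj1 := hcoord j
      have hj2 := hcoord' j
      rw [if_neg hji, hi, sub_zero] at hi1
      rw [hi] at hi2
      rw [if_pos rfl] at hj1
      have hdj0 : 0 ≤ d j := hdnn j hji
      have habove : 0 ≤ d i + d j * ((1 : ℕ) / r) := by
        rw [← hi1]
        refine hv.above p hp hpt hfp (fun l => (tripleBasis v hv.linInd).coord l p)
          (sum_coord_smul v hv.linInd p).symm fun l hl => ?_
        rw [hcoord]
        have := hdnn l hl
        split_ifs with h
        · subst h
          have : 0 ≤ d j * ((a j : ℝ) / r) := mul_nonneg hdj0 haj'.le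
          linarith
        · have : 0 ≤ d j * ((a l : ℝ) / r) := mul_nonneg hdj0 (by positivity)
          linarith
      have hdj1 : d j ≤ 1 := by
        have := congrArg f hd
        rw [hfp, map_sum] at this
        simp only [map_smul, smul_eq_mul] at this
        have hterm : ∀ l, 0 ≤ d l * f (Function.update v j c l) := by
          intro l
          by_cases hli : l = i
          · subst hli
            rw [Function.update_of_ne hji.symm, hfi, mul_zero]
          · refine mul_nonneg (hdnn l hli) ?_
            by_cases hlj : l = j
            · subst hlj; rw [Function.update_self, hf1]; norm_num
            · rw [Function.update_of_ne hlj, (hv.mem l hli).2.2.1]; norm_num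
        have h1 := Finset.single_le_sum (fun l _ => hterm l) (Finset.mem_univ j)
        rw [Function.update_self, hf1, mul_one, ← this] at h1
        exact h1
      by_contra! hneg
      push_cast at hi1 hi2 habove
      have e1 : ((n i * r + m : ℤ) : ℝ) = d i * r + d j := by
        push_cast
        have : (n i : ℝ) + m * (1 / r) = d i + d j * (1 / r) := by linarith
        field_simp at this
        linarith
      have h1 : (0 : ℝ) ≤ d i * r + d j := by
        have := mul_nonneg habove hr0.le
        field_simp at this
        linarith
      have h2 : d i * r + d j < 1 := by
        have := mul_neg_of_neg_of_pos hneg hr0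
        linarith
      rw [← e1] at h1 h2
      have hz : n i * r + m = 0 := by
        have h1' : 0 ≤ n i * r + m := by exact_mod_cast h1
        have h2' : n i * r + m < 1 := by exact_mod_cast h2
        omega
      -- `p` lies in the face spanned by the two other generators, so its coordinates are integral
      have hm : (m : ℝ) = -(n i * r) := by
        have : ((n i * r + m : ℤ) : ℝ) = 0 := by rw [hz]; norm_num
        push_cast at this
        linarith
      have e2 : d j * ((a j : ℝ) / r) = ((n j - n i * a j : ℤ) : ℝ) := by
        have : d j * ((a j : ℝ) / r) = n j + m * ((a j : ℝ) / r) := by linarith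
        rw [this, hm]
        push_cast
        field_simp
        ring
      have h3 : d j * ((a j : ℝ) / r) < 1 := by
        have : (a j : ℝ) / r < 1 := by
          rw [div_lt_one hr0]; exact_mod_cast ha j
        nlinarith
      have h4 : 0 ≤ d j * ((a j : ℝ) / r) := mul_nonneg hdj0 haj'.le
      have h5 : d j * ((a j : ℝ) / r) = 0 := by
        rw [e2] at h3 h4 ⊢
        have h3' : n j - n i * a j < 1 := by exact_mod_cast h3
        have h4' : 0 ≤ n j - n i * a j := by exact_mod_cast h4
        have : n j - n i * a j = 0 := by omega
        rw [this]; norm_num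
      have h6 : d j = 0 := (mul_eq_zero.1 h5).resolve_right haj'.ne'
      rw [h6, zero_mul, add_zero] at habove
      linarith
  · refine ⟨ht, rfl, fun k hk => ⟨(htL k).1,
      PointedCone.subset_hull (Set.mem_range_self k), ?_, ?_⟩,
      ?_⟩
    · rw [hfx, (htL k).2.2, hφ, coord_self, if_neg hk, sub_zero]
    · rw [(htL k).2.2]; norm_num
    · rintro p - hpt - d rfl -
      have := (mem_hull_iff_coord ht).1 hpt i
      rwa [coord_sum] at this

/-! ### Iterated Fujiki–Oka resolutions -/

/-- The standard basis of `ℝ³`. -/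
def stdTriple : Fin 3 → V := fun j => Pi.single j 1

lemma linearIndependent_stdTriple : LinearIndependent ℝ stdTriple := by
  have := (Pi.basisFun ℝ (Fin 3)).linearIndependent
  convert this using 1
  ext j
  simp [stdTriple]

lemma sum_smul_stdTriple (x : V) : ∑ j, x j • stdTriple j = x := by
  funext i
  simp [stdTriple, Finset.sum_apply, Pi.single_apply]

lemma hull_stdTriple : PointedCone.hull ℝ (Set.range stdTriple) = orthant := by
  apply le_antisymm
  · refine hull_le fun j => ?_
    change (0 : V) ≤ Pi.single j 1
    exact Pi.single_nonneg.2 zero_le_one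
  · intro x hx
    rw [← sum_smul_stdTriple x]
    exact sum_smul_mem_hull fun j => hx j

lemma stdTriple_mem_orthant (j : Fin 3) : stdTriple j ∈ orthant := by
  rw [← hull_stdTriple]; exact PointedCone.subset_hull (Set.mem_range_self j)

lemma age_stdTriple (j : Fin 3) : age (stdTriple j) = 1 := by
  simp [age, stdTriple]

lemma isPrimitive_of_age_eq_one {L : AddSubgroup V} (hcan : IsCanonical L) {x : V} (hL : x ∈ L)
    (hx : x ∈ orthant) (h1 : age x = 1) : IsPrimitive L x := by
  have h0 : x ≠ 0 := fun h => by rw [h] at h1; simp [age] at h1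
  refine ⟨hL, h0, fun s hs0 hs1 hs => ?_⟩
  have := hcan _ hs (PointedCone.smul_mem _ hs0.le hx) (smul_ne_zero hs0.ne' h0)
  rw [← ageHom_apply, map_smul, ageHom_apply, h1, smul_eq_mul] at this
  linarith

lemma mem_hilbertBasis_of_age_eq_one {L : AddSubgroup V} (hcan : IsCanonical L) {x : V}
    (hL : x ∈ L) (hx : x ∈ orthant) (h1 : age x = 1) : x ∈ hilbertBasis L orthant :=
  mem_hilbertBasis_of_age_lt hcan hL hx (fun h => by rw [h] at h1; simp [age] at h1)
    (by rw [h1]; norm_num)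

/-- A crepant Fujiki–Oka resolution for a sublattice `M`, followed by Fujiki–Oka resolutions of its
cones that only add irreducible elements of `N`, is a Hilbert desingularization. -/
theorem exists_iterated {M N : AddSubgroup V} (hMN : M ≤ N) (hcan : IsCanonical N) {i : Fin 3}
    {T₁ : Set (Fin 3 → V)} (hstd : ∀ j, stdTriple j ∈ M) (hT₁ : FujikiOka M i stdTriple T₁)
    (hage : ∀ t ∈ T₁, ∀ j, t j ∈ M ∧ t j ∈ orthant ∧ age (t j) = 1)
    (hT₂ : ∀ t ∈ T₁, ∃ i T, FujikiOka N i t T ∧ ∀ t' ∈ T, ∀ j, t' j ∈ hilbertBasis N orthant) :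
    IsFujikiOkaResolution M orthant T₁ ∧ ∃ T₂ : (Fin 3 → V) → Set (Fin 3 → V),
      (∀ t ∈ T₁, IsFujikiOkaResolution N (PointedCone.hull ℝ (Set.range t)) (T₂ t)) ∧
      IsHilbertDesingularization N orthant (fanOf (⋃ t ∈ T₁, T₂ t)) := by
  classical
  have hcanM : IsCanonical M := fun x hx => hcan x (hMN hx)
  have htri := hT₁.triangulation linearIndependent_stdTriple fun t ht j =>
    mem_hilbertBasis_of_age_eq_one hcanM (hage t ht j).1 (hage t ht j).2.1 (hage t ht j).2.2
  obtain ⟨hfin, hHil, hU, hF⟩ := htri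
  rw [hull_stdTriple] at hU
  refine ⟨⟨stdTriple, i, linearIndependent_stdTriple, fun j => isPrimitive_of_age_eq_one hcanM
    (hstd j) (stdTriple_mem_orthant j) (age_stdTriple j), hull_stdTriple, hT₁⟩, ?_⟩
  -- the second resolution is chosen for each cone, not for each ordering of its generators
  have hex : ∀ C : PointedCone ℝ V, ∃ T, (∃ t ∈ T₁, PointedCone.hull ℝ (Set.range t) = C) →
      IsFujikiOkaResolution N C T ∧ ∀ t' ∈ T, ∀ j, t' j ∈ hilbertBasis N orthant := by
    intro C
    by_cases h : ∃ t ∈ T₁, PointedCone.hull ℝ (Set.range t) = C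
    · obtain ⟨t, ht, rfl⟩ := h
      obtain ⟨i, T, hT, hQ⟩ := hT₂ t ht
      refine ⟨T, fun _ => ⟨⟨t, i, (hHil t ht).linInd, fun j => ?_, rfl, hT⟩, hQ⟩⟩
      exact isPrimitive_of_age_eq_one hcan (hMN (hage t ht j).1) (hage t ht j).2.1 (hage t ht j).2.2
    · exact ⟨∅, fun h' => absurd h' h⟩
  choose F hFO using hex
  have hres : ∀ t ∈ T₁, _ := fun t ht => hFO (PointedCone.hull ℝ (Set.range t)) ⟨t, ht, rfl⟩
  have htri : ∀ t ∈ T₁, (F (PointedCone.hull ℝ (Set.range t))).Finite ∧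
      (∀ t' ∈ F (PointedCone.hull ℝ (Set.range t)), IsHilbertTriple N t') ∧
      ⋃ t' ∈ F (PointedCone.hull ℝ (Set.range t)), (PointedCone.hull ℝ (Set.range t') : Set V) =
        PointedCone.hull ℝ (Set.range t) ∧
      ∀ t₁ ∈ F (PointedCone.hull ℝ (Set.range t)), ∀ t₂ ∈ F (PointedCone.hull ℝ (Set.range t)),
        FaceToFace (Set.range t₁) (Set.range t₂) := by
    intro t ht
    obtain ⟨⟨v, i, hv, -, hvt, hFv⟩, hQ⟩ := hres t ht
    rw [← hvt] at hFv hQ ⊢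
    exact hFv.triangulation hv hQ
  refine ⟨fun t => F (PointedCone.hull ℝ (Set.range t)), fun t ht => (hres t ht).1, ?_⟩
  have hin : ∀ t ∈ T₁, ∀ t' ∈ F (PointedCone.hull ℝ (Set.range t)), ∀ m,
      t' m ∈ PointedCone.hull ℝ (Set.range t) := by
    intro t ht t' ht' m
    rw [← SetLike.mem_coe, ← (htri t ht).2.2.1]
    exact Set.mem_biUnion ht' (PointedCone.subset_hull (Set.mem_range_self m))
  apply isHilbertDesingularization_fanOf
  · exact hfin.biUnion fun t ht => (htri t ht).1
  · intro t' ht'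
    obtain ⟨t, ht, ht'⟩ := Set.mem_iUnion₂.1 ht'
    exact (htri t ht).2.1 t' ht'
  · intro t₁ ht₁ t₂ ht₂
    obtain ⟨s₁, hs₁, ht₁⟩ := Set.mem_iUnion₂.1 ht₁
    obtain ⟨s₂, hs₂, ht₂⟩ := Set.mem_iUnion₂.1 ht₂
    by_cases h1 : ∃ k, s₁ k ∉ Set.range s₂
    · obtain ⟨k, hk⟩ := h1
      exact faceToFace_of_parts (hHil s₁ hs₁).linInd (hHil s₂ hs₂).linInd (hF s₁ hs₁ s₂ hs₂) hk
        (hin s₁ hs₁ t₁ ht₁) (hin s₂ hs₂ t₂ ht₂) ((htri s₁ hs₁).2.1 t₁ ht₁)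
        ((htri s₂ hs₂).2.1 t₂ ht₂)
    by_cases h2 : ∃ k, s₂ k ∉ Set.range s₁
    · obtain ⟨k, hk⟩ := h2
      exact (faceToFace_of_parts (hHil s₂ hs₂).linInd (hHil s₁ hs₁).linInd (hF s₂ hs₂ s₁ hs₁) hk
        (hin s₂ hs₂ t₂ ht₂) (hin s₁ hs₁ t₁ ht₁) ((htri s₂ hs₂).2.1 t₂ ht₂)
        ((htri s₁ hs₁).2.1 t₁ ht₁)).symm
    push Not at h1 h2
    have hrange : Set.range s₁ = Set.range s₂ := by
      apply Set.Subset.antisymm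
      · rintro _ ⟨k, rfl⟩; exact h1 k
      · rintro _ ⟨k, rfl⟩; exact h2 k
    refine (htri s₁ hs₁).2.2.2 t₁ ht₁ t₂ ?_
    rw [hrange]
    exact ht₂
  · rw [← hU, Set.biUnion_iUnion]
    simp only [Set.biUnion_iUnion]
    exact Set.iUnion₂_congr fun t ht => (htri t ht).2.2.1

/-! ### The terminal lemma -/

/-- With `n = m - a`, the assumptions say that `n (X - 1) ≤ a`, that `n (u' - u - 1) > 2 a`, and
that `u' - u - 1 ≤ X`. -/
lemma jumps_contradiction {m a X u u' : ℕ} (ham : a ≤ m) (hX : 2 ≤ X) (haX : m * (X - 1) ≤ a * X)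
    (hu : u + 1 ≤ u') (hD : a * (u' + 1) + m * (u + 1) < a * u + m * u')
    (hgap : u' ≤ u + 1 + X) : False := by
  obtain ⟨Y, rfl⟩ : ∃ Y, X = Y + 1 := ⟨X - 1, by omega⟩
  obtain ⟨n, rfl⟩ := Nat.exists_eq_add_of_le ham
  simp only [Nat.add_sub_cancel] at haX
  obtain ⟨e, rfl⟩ := Nat.exists_eq_add_of_le hu
  have hn1 : n * Y ≤ a := by linarith
  have hn2 : 2 * a < n * e := by linarith
  have hn3 : n * e ≤ n * (Y + 1) := Nat.mul_le_mul_left n (by omega)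
  have hn4 : n * 1 ≤ n * Y := Nat.mul_le_mul_left n (by omega)
  linarith

/-- The terminal lemma for ordered weights. By hypothesis exactly one of the floor functions
`⌊a k / m⌋`, `⌊b k / m⌋`, `⌊c k / m⌋` jumps when `k` increases by one. The jumps of `a` start with a
run of length `⌈m / b⌉ - 2`, so two successive other jumps are almost `⌈m / b⌉` apart; this leaves
no room for a jump of `c` between two successive jumps of `b`. -/
lemma eq_one_of_jumps {m a b c : ℕ} (hba : b ≤ a) (hcb : c ≤ b) (hc : 0 < c)
    (habc : a + b + c = m + 1)
    (hF : ∀ k, 0 < k → k < m → a * k / m + b * k / m + c * k / m + 1 = k) : c = 1 := by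
  by_contra hc1
  have hc2 : 2 ≤ c := by omega
  have hm : 0 < m := by omega
  have ham : a ≤ m := by omega
  have hmono : ∀ d x y : ℕ, x ≤ y → d * x / m ≤ d * y / m := fun d x y h =>
    Nat.div_le_div_right (Nat.mul_le_mul_left d h)
  -- `⌈n / d⌉`
  have hceil : ∀ n d : ℕ, 0 < d → 0 < n → ∃ x, n ≤ d * (x + 1) ∧ d * x < n := by
    intro n d hd hn
    refine ⟨(n - 1) / d, ?_, ?_⟩
    · have := Nat.lt_mul_div_succ (n - 1) hd
      omega
    · have := Nat.mul_div_le (n - 1) d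
      omega
  have hstep : ∀ x, 0 < x → x + 1 < m →
      b * x / m < b * (x + 1) / m ∨ c * x / m < c * (x + 1) / m →
      a * (x + 1) / m = a * x / m := by
    intro x hx hxm h
    have h1 := hF x hx (by omega)
    have h2 := hF (x + 1) (by omega) hxm
    have := hmono a x (x + 1) (by omega)
    have := hmono b x (x + 1) (by omega)
    have := hmono c x (x + 1) (by omega)
    omega
  -- the first jump of `c`, at `y + 1`
  obtain ⟨y, hy1, hy2⟩ := hceil m c hc hm
  have hym : y + 1 < m := by
    have : 2 * y ≤ c * y := Nat.mul_le_mul_right y hc2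
    omega
  have hy0 : 0 < y := by
    rcases Nat.eq_zero_or_pos y with h | h
    · subst h; omega
    · exact h
  have hcy : c * y / m = 0 := Nat.div_eq_of_lt hy2
  have hcy1 : 1 ≤ c * (y + 1) / m := (Nat.one_le_div_iff hm).2 hy1
  have hay := hstep y hy0 hym (.inr (by omega))
  have hby : b * (y + 1) / m = b * y / m := by
    have h1 := hF y hy0 (by omega)
    have h2 := hF (y + 1) (by omega) hym
    have := hmono b y (y + 1) (by omega)
    omega
  set q := b * y / m with hq
  have hq1 : 1 ≤ q := by
    rw [← hby]
    exact (Nat.one_le_div_iff hm).2 (hy1.trans (Nat.mul_le_mul_right _ hcb))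
  have hqy : q * m ≤ b * y := Nat.div_mul_le_self _ _
  have hqy' : b * (y + 1) < (q + 1) * m := by
    have := Nat.lt_mul_div_succ (b * (y + 1)) hm
    rw [hby] at this
    linarith
  have hqb : q + 2 ≤ b := by
    have h1 : q * c * m < b * m := by
      calc q * c * m = c * (q * m) := by ring
        _ ≤ c * (b * y) := Nat.mul_le_mul_left _ hqy
        _ = b * (c * y) := by ring
        _ < b * m := Nat.mul_lt_mul_of_pos_left hy2 (by omega)
    have h2 := lt_of_mul_lt_mul_right h1 (Nat.zero_le m)
    have h3 : q * 2 ≤ q * c := Nat.mul_le_mul_left q hc2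
    omega
  -- the jumps of `b` before and after it, at `u + 1` and `u' + 1`
  obtain ⟨u, hu1, hu2⟩ := hceil (q * m) b (by omega) (by positivity)
  obtain ⟨u', hu1', hu2'⟩ := hceil ((q + 1) * m) b (by omega) (by positivity)
  have huy : u < y := lt_of_mul_lt_mul_left (hu2.trans_le hqy) (Nat.zero_le b)
  have hyu : y + 1 < u' + 1 := lt_of_mul_lt_mul_left (hqy'.trans_le hu1') (Nat.zero_le b)
  have hu0 : 0 < u := by
    rcases Nat.eq_zero_or_pos u with h | h
    · subst h
      have : 1 * m ≤ q * m := Nat.mul_le_mul_right m hq1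
      omega
    · exact h
  have hum : u' + 1 < m := by
    have h1 : (q + 1) * m + m ≤ b * m := by
      calc (q + 1) * m + m = (q + 2) * m := by ring
        _ ≤ b * m := Nat.mul_le_mul_right m hqb
    have h2 : b * u' + b < b * m := by omega
    have h3 : b * (u' + 1) < b * m := by linarith
    exact lt_of_mul_lt_mul_left h3 (Nat.zero_le b)
  have hau := hstep u hu0 (by omega) (.inl (lt_of_lt_of_le
    ((Nat.div_lt_iff_lt_mul hm).2 hu2) ((Nat.le_div_iff_mul_le hm).2 hu1)))
  have hau' := hstep u' (by omega) hum (.inl (lt_of_lt_of_le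
    ((Nat.div_lt_iff_lt_mul hm).2 hu2') ((Nat.le_div_iff_mul_le hm).2 hu1')))
  have hslow : ∀ x d : ℕ, a * (x + d) / m ≤ a * x / m + d := by
    intro x d
    calc a * (x + d) / m ≤ (a * x + d * m) / m :=
          Nat.div_le_div_right (by
            have := Nat.mul_le_mul_right d ham
            linarith)
      _ = a * x / m + d := Nat.add_mul_div_right _ _ hm
  have hs1 := hslow (u + 1) (y - (u + 1))
  have hs2 := hslow (y + 1) (u' - (y + 1))
  rw [Nat.add_sub_cancel' (by omega)] at hs1 hs2
  have htot : a * (u' + 1) / m + (u + 2) ≤ a * u / m + u' := by omega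
  have hD : a * (u' + 1) + m * (u + 1) < a * u + m * u' := by
    have h1 := Nat.lt_mul_div_succ (a * (u' + 1)) hm
    have h2 := Nat.mul_div_le (a * u) m
    have h3 := Nat.mul_le_mul_left m htot
    linarith
  -- the first jump of `b`, at `X + 1`
  obtain ⟨X, hX1, hX2⟩ := hceil m b (by omega) hm
  have hX : 2 ≤ X := by
    by_contra! hlt
    have : b * (X + 1) ≤ b * 2 := Nat.mul_le_mul_left b (by omega)
    omega
  have hXm : X < m := by
    have : 2 * X ≤ b * X := Nat.mul_le_mul_right X (by omega)
    omega
  have haX : m * (X - 1) ≤ a * X := by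
    have h1 := hF X (by omega) hXm
    rw [Nat.div_eq_of_lt hX2, Nat.div_eq_of_lt ((Nat.mul_le_mul_right X hcb).trans_lt hX2)] at h1
    have h2 := Nat.mul_div_le (a * X) m
    have : a * X / m = X - 1 := by omega
    rwa [this] at h2
  have hgap : u' ≤ u + 1 + X := by
    have h1 : b * u' < b * (u + 1 + (X + 1)) := by linarith
    have := lt_of_mul_lt_mul_left h1 (Nat.zero_le b)
    omega
  exact jumps_contradiction ham hX haX (by omega) hD hgap

/-- The terminal lemma: if the residues of `a k`, `b k`, `c k` modulo `m` add up to `m + k` for all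
`0 < k < m`, then one of the weights is `1`, and the sum of the other two is `m`. -/
lemma eq_one_of_residues {m : ℕ} {a : Fin 3 → ℕ} (hm : 1 < m) (ha : ∀ j, 0 < a j ∧ a j < m)
    (h : ∀ k, 0 < k → k < m → a 0 * k % m + a 1 * k % m + a 2 * k % m = m + k) :
    ∃ j, a j = 1 := by
  have hsum : a 0 + a 1 + a 2 = m + 1 := by
    have := h 1 one_pos hm
    simpa [Nat.mod_eq_of_lt (ha _).2] using this
  have hF : ∀ k, 0 < k → k < m → a 0 * k / m + a 1 * k / m + a 2 * k / m + 1 = k := by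
    intro k h0 hk
    have h1 := Nat.div_add_mod (a 0 * k) m
    have h2 := Nat.div_add_mod (a 1 * k) m
    have h3 := Nat.div_add_mod (a 2 * k) m
    have h4 := h k h0 hk
    have h5 : m * (a 0 * k / m + a 1 * k / m + a 2 * k / m + 1) = m * k := by
      have : (a 0 + a 1 + a 2) * k = (m + 1) * k := by rw [hsum]
      linarith
    exact Nat.eq_of_mul_eq_mul_left (by omega) h5
  rcases le_total (a 0) (a 1) with h01 | h01 <;> rcases le_total (a 1) (a 2) with h12 | h12 <;>
    rcases le_total (a 0) (a 2) with h02 | h02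
  · exact ⟨0, eq_one_of_jumps (m := m) h12 h01 (ha 0).1 (by omega) fun k h0 hk => by
      have := hF k h0 hk; omega⟩
  · exact ⟨0, eq_one_of_jumps (m := m) h12 h01 (ha 0).1 (by omega) fun k h0 hk => by
      have := hF k h0 hk; omega⟩
  · exact ⟨0, eq_one_of_jumps (m := m) h12 h02 (ha 0).1 (by omega) fun k h0 hk => by
      have := hF k h0 hk; omega⟩
  · exact ⟨2, eq_one_of_jumps (m := m) h01 h02 (ha 2).1 (by omega) fun k h0 hk => by
      have := hF k h0 hk; omega⟩
  · exact ⟨1, eq_one_of_jumps (m := m) h02 h01 (ha 1).1 (by omega) fun k h0 hk => by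
      have := hF k h0 hk; omega⟩
  · exact ⟨1, eq_one_of_jumps (m := m) h02 h12 (ha 1).1 (by omega) fun k h0 hk => by
      have := hF k h0 hk; omega⟩
  · exact ⟨2, eq_one_of_jumps (m := m) h01 h12 (ha 2).1 (by omega) fun k h0 hk => by
      have := hF k h0 hk; omega⟩
  · exact ⟨2, eq_one_of_jumps (m := m) h01 h12 (ha 2).1 (by omega) fun k h0 hk => by
      have := hF k h0 hk; omega⟩

/-! ### Cyclic overlattices -/

/-- A cyclic overlattice `L` of `K` on which a functional `f` is faithful modulo `ℤ` is generated
over `K` by a vector on which `f` takes the value `1 / m`. -/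
lemma exists_generator {K L : AddSubgroup V} {w : V} {n : ℕ} (hn : 0 < n)
    (hL : L = AddSubgroup.closure ((K : Set V) ∪ {w})) (hw : (n : ℝ) • w ∈ K) (f : V →ₗ[ℝ] ℝ)
    (hfK : ∀ x ∈ K, ∃ k : ℤ, f x = k) {κ : V} (hκ : κ ∈ K) (hfκ : f κ = 1)
    (hf : ∀ x ∈ L, (∃ k : ℤ, f x = k) → x ∈ K) :
    ∃ m : ℕ, 0 < m ∧ ∃ x ∈ L, f x = 1 / m ∧ (m : ℝ) • x ∈ K ∧
      L = AddSubgroup.closure ((K : Set V) ∪ {x}) := by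
  have hKL : ∀ x ∈ K, x ∈ L := fun x hx => hL ▸ mem_closure_left hx
  have hwL : w ∈ L := hL ▸ mem_closure_right
  obtain ⟨p₀, hp₀⟩ := hfK _ hw
  rw [map_smul, smul_eq_mul] at hp₀
  have hn' : (n : ℝ) ≠ 0 := by positivity
  set q : ℚ := p₀ / n with hq
  have hfw : f w = (q.num : ℝ) / q.den := by
    have h1 : f w = ((q : ℚ) : ℝ) := by
      rw [hq]; push_cast; field_simp; linarith
    rw [h1]
    exact Rat.cast_def q
  have hden : (q.den : ℝ) ≠ 0 := by exact_mod_cast q.den_nz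
  have hcop : IsCoprime q.num (q.den : ℤ) := by
    rw [Int.isCoprime_iff_gcd_eq_one]
    exact q.reduced
  obtain ⟨u, v, huv⟩ := hcop
  have huv' : (u : ℝ) * q.num + v * q.den = 1 := by exact_mod_cast huv
  have hx : (u : ℝ) • w + (v : ℝ) • κ ∈ L :=
    L.add_mem (int_smul_mem hwL u) (int_smul_mem (hKL κ hκ) v)
  have hfx : f ((u : ℝ) • w + (v : ℝ) • κ) = 1 / q.den := by
    rw [map_add, map_smul, map_smul, hfw, hfκ, smul_eq_mul, smul_eq_mul, mul_one]
    field_simp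
    linarith
  refine ⟨q.den, q.den_pos, _, hx, hfx, ?_, ?_⟩
  · refine hf _ (nat_smul_mem hx _) ⟨1, ?_⟩
    rw [map_smul, hfx, smul_eq_mul]
    field_simp
    norm_num
  · have hdiff : w - (q.num : ℝ) • ((u : ℝ) • w + (v : ℝ) • κ) ∈ K := by
      refine hf _ (L.sub_mem hwL (int_smul_mem hx _)) ⟨0, ?_⟩
      rw [map_sub, map_smul, hfx, hfw, smul_eq_mul]
      push_cast
      ring
    conv_lhs => rw [hL]
    refine closure_union_singleton_congr (fun s hs => mem_closure_left hs) ?_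
      (fun s hs => mem_closure_left hs) (hL ▸ hx)
    have := AddSubgroup.add_mem _ (mem_closure_left (x := (u : ℝ) • w + (v : ℝ) • κ) hdiff)
      (int_smul_mem mem_closure_right q.num)
    rwa [sub_add_cancel] at this

lemma mem_closure_subgroup_union {K : AddSubgroup V} {w x : V} :
    x ∈ AddSubgroup.closure ((K : Set V) ∪ {w}) ↔ ∃ k : ℤ, x - (k : ℝ) • w ∈ K := by
  rw [AddSubgroup.closure_union, AddSubgroup.mem_sup, AddSubgroup.closure_eq]
  simp only [AddSubgroup.mem_closure_singleton]
  constructor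
  · rintro ⟨y, hy, _, ⟨k, rfl⟩, rfl⟩
    exact ⟨k, by rwa [Int.cast_smul_eq_zsmul, add_sub_cancel_right]⟩
  · rintro ⟨k, hk⟩
    exact ⟨_, hk, _, ⟨k, rfl⟩, by rw [Int.cast_smul_eq_zsmul, sub_add_cancel]⟩

/-- An intermediate lattice of a cyclic extension of lattices is a cyclic extension. -/
lemma exists_intermediate_generator {K M L : AddSubgroup V} {w : V} (hKM : K ≤ M) (hML : M ≤ L)
    (hL : L = AddSubgroup.closure ((K : Set V) ∪ {w})) :
    ∃ d : ℤ, M = AddSubgroup.closure ((K : Set V) ∪ {(d : ℝ) • w}) := by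
  let A : AddSubgroup ℤ :=
    { carrier := {k | (k : ℝ) • w ∈ M}
      zero_mem' := by simp [M.zero_mem]
      add_mem' := fun {a b} ha hb => by
        change ((a + b : ℤ) : ℝ) • w ∈ M
        rw [Int.cast_add, add_smul]; exact M.add_mem ha hb
      neg_mem' := fun {a} ha => by
        change ((-a : ℤ) : ℝ) • w ∈ M
        rw [Int.cast_neg, neg_smul]; exact M.neg_mem ha }
  obtain ⟨d, hd⟩ := Int.subgroup_cyclic A
  refine ⟨d, le_antisymm ?_ ?_⟩
  · intro x hx
    obtain ⟨k, hk⟩ := mem_closure_subgroup_union.1 (hL ▸ hML hx)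
    have hkA : k ∈ A := by
      have := M.sub_mem hx (hKM hk)
      rwa [sub_sub_cancel] at this
    rw [hd] at hkA
    obtain ⟨e, he⟩ := AddSubgroup.mem_closure_singleton.1 hkA
    refine mem_closure_subgroup_union.2 ⟨e, ?_⟩
    rw [smul_smul]
    rw [← he] at hk
    convert hk using 3
    simp
  · rw [AddSubgroup.closure_le]
    rintro s (hs | rfl)
    · exact hKM hs
    · have : d ∈ A := hd ▸ AddSubgroup.subset_closure rfl
      exact this

/-! ### Canonical cyclic lattices -/

/-- The lattice `ℤ³`. -/
def intLattice : AddSubgroup V where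
  carrier := {x | ∀ j, ∃ n : ℤ, x j = n}
  zero_mem' := fun _ => ⟨0, by simp⟩
  add_mem' := fun {x y} hx hy j => by
    obtain ⟨n, hn⟩ := hx j
    obtain ⟨m, hm⟩ := hy j
    exact ⟨n + m, by simp [hn, hm]⟩
  neg_mem' := fun {x} hx j => by
    obtain ⟨n, hn⟩ := hx j
    exact ⟨-n, by simp [hn]⟩

lemma mem_intLattice {x : V} : x ∈ intLattice ↔ ∀ j, ∃ n : ℤ, x j = n := Iff.rfl

lemma stdTriple_apply (j k : Fin 3) : stdTriple j k = if k = j then 1 else 0 := by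
  simp [stdTriple, Pi.single_apply]

lemma stdTriple_mem_intLattice (j : Fin 3) : stdTriple j ∈ intLattice := fun k => by
  rw [stdTriple_apply]
  split_ifs
  exacts [⟨1, by simp⟩, ⟨0, by simp⟩]

lemma intLattice_eq_closure : intLattice = AddSubgroup.closure (Set.range stdTriple) := by
  apply le_antisymm
  · intro x hx
    choose n hn using hx
    refine mem_closure_range.2 ⟨n, ?_⟩
    simp only [← hn]
    exact sum_smul_stdTriple x
  · rw [AddSubgroup.closure_le]
    rintro _ ⟨j, rfl⟩
    exact stdTriple_mem_intLattice j

lemma fract_mem {N : AddSubgroup V} (hN : intLattice ≤ N) {x : V} (hx : x ∈ N) :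
    (fun k => Int.fract (x k)) ∈ N := by
  have h : (fun k => (⌊x k⌋ : ℝ)) ∈ N := hN fun k => ⟨_, rfl⟩
  exact N.sub_mem hx h

/-- In a canonical lattice, the fractional parts of a nonintegral vector add up to at least `1`. -/
lemma one_le_sum_fract {N : AddSubgroup V} (hN : intLattice ≤ N) (hcan : IsCanonical N) {x : V}
    (hx : x ∈ N) (hx0 : x ∉ intLattice) : 1 ≤ ∑ k, Int.fract (x k) := by
  refine hcan _ (fract_mem hN hx) (fun k => Int.fract_nonneg _) fun h0 => hx0 fun k => ?_
  have h : Int.fract (x k) = 0 := congrFun h0 k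
  have := Int.floor_add_fract (x k)
  exact ⟨⌊x k⌋, by linarith⟩

lemma sum_fin_three_cyclic (f : Fin 3 → ℝ) (j : Fin 3) :
    ∑ k, f k = f j + f (j + 1) + f (j + 2) := by
  fin_cases j
  · simp [Fin.sum_univ_three]
  · simp [Fin.sum_univ_three]; ring
  · simp [Fin.sum_univ_three]; ring

lemma cyclic_ne : ∀ j : Fin 3, j ≠ j + 1 ∧ j ≠ j + 2 ∧ j + 1 ≠ j + 2 := by decide

lemma cyclic_add : ∀ j : Fin 3, j + 1 + 1 = j + 2 ∧ j + 1 + 2 = j ∧ j + 2 + 1 = j ∧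
    j + 2 + 2 = j + 1 := by decide

lemma cyclic_cases : ∀ j k : Fin 3, k = j ∨ k = j + 1 ∨ k = j + 2 := by decide

lemma forall_fin_three_cyclic {p : Fin 3 → Prop} {j : Fin 3} (h0 : p j) (h1 : p (j + 1))
    (h2 : p (j + 2)) (k : Fin 3) : p k := by
  rcases cyclic_cases j k with rfl | rfl | rfl
  exacts [h0, h1, h2]

/-- A nonintegral element of a canonical lattice whose `j`-th coordinate is integral is of type
`1/p (0, 1, -1)`: the fractional parts of its other coordinates, and those of its negative, add up
to at least `1`. -/
lemma exists_int_add {N : AddSubgroup V} (hN : intLattice ≤ N) (hcan : IsCanonical N) {x : V}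
    (hx : x ∈ N) {j : Fin 3} (hj : ∃ n : ℤ, x j = n) : ∃ n : ℤ, x (j + 1) + x (j + 2) = n := by
  by_cases hint : x ∈ intLattice
  · obtain ⟨m, hm⟩ := hint (j + 1)
    obtain ⟨n, hn⟩ := hint (j + 2)
    exact ⟨m + n, by rw [hm, hn]; push_cast; ring⟩
  have hneg : -x ∉ intLattice := fun h => hint (neg_mem_iff.1 h)
  have h1 := one_le_sum_fract hN hcan hx hint
  have h2 := one_le_sum_fract hN hcan (N.neg_mem hx) hneg
  obtain ⟨n, hn⟩ := hj
  rw [sum_fin_three_cyclic _ j] at h1 h2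
  have hn' : Int.fract (-(n : ℝ)) = 0 := by rw [← Int.cast_neg, Int.fract_intCast]
  simp only [Pi.neg_apply, hn, hn', Int.fract_intCast, zero_add] at h1 h2
  have key : ∀ y : ℝ, Int.fract y + Int.fract (-y) ≤ 1 := fun y => by
    by_cases hy : Int.fract y = 0
    · rw [Int.fract_neg_eq_zero.2 hy, hy]; norm_num
    · rw [Int.fract_neg hy]; linarith
  have k1 := key (x (j + 1))
  have k2 := key (x (j + 2))
  refine ⟨⌊x (j + 1)⌋ + ⌊x (j + 2)⌋ + 1, ?_⟩
  have e1 := Int.floor_add_fract (x (j + 1))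
  have e2 := Int.floor_add_fract (x (j + 2))
  push_cast
  linarith

/-- `N` is a cyclic extension of `ℤ³`: it is generated over `ℤ³` by one vector `w` of finite
order modulo `ℤ³`. -/
def IsCyclicLattice (N : AddSubgroup V) : Prop :=
  ∃ (w : V) (n : ℕ), 0 < n ∧ (n : ℝ) • w ∈ intLattice ∧
    N = AddSubgroup.closure ((intLattice : Set V) ∪ {w})

lemma IsCyclicLattice.intLattice_le {N : AddSubgroup V} (h : IsCyclicLattice N) :
    intLattice ≤ N := by
  obtain ⟨w, n, -, -, hN⟩ := h
  intro x hx
  rw [hN]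
  exact mem_closure_left hx

lemma IsCyclicLattice.of_le {N M : AddSubgroup V} (h : IsCyclicLattice N) (hM : intLattice ≤ M)
    (hMN : M ≤ N) : IsCyclicLattice M := by
  obtain ⟨w, n, hn, hw, hN⟩ := h
  obtain ⟨d, hd⟩ := exists_intermediate_generator hM hMN hN
  refine ⟨_, n, hn, ?_, hd⟩
  rw [smul_comm]
  exact int_smul_mem hw d

/-- The sublattice of the vectors of `N` on which a functional `f` is integral. -/
def integralPart (N : AddSubgroup V) (f : V →ₗ[ℝ] ℝ) : AddSubgroup V where
  carrier := {x | x ∈ N ∧ ∃ n : ℤ, f x = n}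
  zero_mem' := ⟨N.zero_mem, 0, by simp⟩
  add_mem' := fun {x y} ⟨hx, n, hn⟩ ⟨hy, m, hm⟩ =>
    ⟨N.add_mem hx hy, n + m, by simp [hn, hm]⟩
  neg_mem' := fun {x} ⟨hx, n, hn⟩ => ⟨N.neg_mem hx, -n, by simp [hn]⟩

lemma integralPart_le (N : AddSubgroup V) (f : V →ₗ[ℝ] ℝ) : integralPart N f ≤ N :=
  fun _ h => h.1

/-- A cyclic extension of `ℤ³` is a cyclic extension of every intermediate lattice. -/
lemma IsCyclicLattice.over {N K : AddSubgroup V} (hN : IsCyclicLattice N) (hZK : intLattice ≤ K)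
    (hKN : K ≤ N) : ∃ (w : V) (n : ℕ), 0 < n ∧ (n : ℝ) • w ∈ K ∧
      N = AddSubgroup.closure ((K : Set V) ∪ {w}) := by
  obtain ⟨w, n, hn, hw, hNw⟩ := hN
  refine ⟨w, n, hn, hZK hw, le_antisymm ?_ ?_⟩
  · conv_lhs => rw [hNw]
    exact AddSubgroup.closure_mono (Set.union_subset_union_left _ hZK)
  · rw [AddSubgroup.closure_le]
    rintro s (hs | rfl)
    · exact hKN hs
    · exact hNw ▸ mem_closure_right

/-- A cyclic lattice which is faithful over the coordinate `j` of a basis `t` of a sublattice `K`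
containing `ℤ³` is semi-unimodular over `t j`. -/
lemma exists_isSemiUnimodular {N K : AddSubgroup V} (hN : IsCyclicLattice N)
    (hZK : intLattice ≤ K) (hKN : K ≤ N) {t : Fin 3 → V} (ht : LinearIndependent ℝ t)
    (hK : K = AddSubgroup.closure (Set.range t)) (j : Fin 3)
    (hf : ∀ x ∈ N, (∃ k : ℤ, (tripleBasis t ht).coord j x = k) → x ∈ K) :
    ∃ r, IsSemiUnimodular N t j r := by
  obtain ⟨w, n, hn, hw, hNw'⟩ := hN.over hZK hKN
  have htK : ∀ k, t k ∈ K := fun k => hK ▸ AddSubgroup.subset_closure (Set.mem_range_self k)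
  have hcoord : ∀ x ∈ K, ∃ a : Fin 3 → ℤ, ∑ k, (a k : ℝ) • t k = x ∧
      ∀ k, (tripleBasis t ht).coord k x = a k := by
    intro x hx
    obtain ⟨a, rfl⟩ := mem_closure_range.1 (hK ▸ hx)
    exact ⟨a, rfl, fun k => coord_sum t ht (fun k => (a k : ℝ)) k⟩
  obtain ⟨m, hm, x, hx, hfx, hmx, hNx⟩ := exists_generator hn hNw' hw
    ((tripleBasis t ht).coord j) (fun x hx => by
      obtain ⟨a, -, ha⟩ := hcoord x hx
      exact ⟨a j, ha j⟩) (htK j) (by rw [coord_self, if_pos rfl]) hf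
  have hm0 : (m : ℝ) ≠ 0 := by positivity
  obtain ⟨a, ha, haj⟩ := hcoord _ hmx
  refine ⟨m, hm, a, ?_, ?_⟩
  · have := haj j
    rw [map_smul, hfx, smul_eq_mul, mul_one_div_cancel hm0] at this
    exact_mod_cast this.symm
  · have e : ∑ k, ((a k : ℝ) / m) • t k = x := by
      have : ∑ k, ((a k : ℝ) / m) • t k = (m : ℝ)⁻¹ • ∑ k, (a k : ℝ) • t k := by
        rw [Finset.smul_sum]
        refine Finset.sum_congr rfl fun k _ => ?_
        rw [smul_smul, div_eq_inv_mul]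
      rw [this, ha, smul_smul, inv_mul_cancel₀ hm0, one_smul]
    rw [e, hNx]
    refine closure_union_singleton_congr (fun s hs => ?_) mem_closure_right ?_ mem_closure_right
    · obtain ⟨b, hb, -⟩ := hcoord s hs
      rw [← hb]
      exact sum_int_smul_mem (fun k => mem_closure_left (Set.mem_range_self k)) _
    · rintro _ ⟨k, rfl⟩
      exact mem_closure_left (htK k)

/-! ### A canonical cyclic lattice with nonintegral ages has a faithful coordinate -/

/-- If some nonintegral element of a canonical cyclic lattice has an integral `j`-th coordinate, the
edge opposite to the `j`-th vertex of the triangle of age `1` is divided into `p ≥ 2` parts. -/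
lemma exists_edge {N : AddSubgroup V} (hN : IsCyclicLattice N) (hcan : IsCanonical N) {j : Fin 3}
    {x : V} (hx : x ∈ N) (hxj : ∃ n : ℤ, x j = n) (hx0 : x ∉ intLattice) :
    ∃ p : ℕ, 2 ≤ p ∧ (1 / p : ℝ) • (stdTriple (j + 1) - stdTriple (j + 2)) ∈ N := by
  have hZ := hN.intLattice_le
  set M := integralPart N (LinearMap.proj j) with hM
  have hZM : intLattice ≤ M := fun y hy => ⟨hZ hy, hy j⟩
  obtain ⟨w, n, hn, hw, hMw⟩ := hN.of_le hZM (integralPart_le _ _)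
  have hsum : ∀ y ∈ M, ∃ n : ℤ, y (j + 1) + y (j + 2) = n := fun y hy =>
    exists_int_add hZ hcan hy.1 hy.2
  obtain ⟨p, hp, y, hy, hyp, -, hMy⟩ := exists_generator hn hMw hw (LinearMap.proj (j + 1))
    (fun y hy => hy (j + 1)) (stdTriple_mem_intLattice (j + 1)) (by simp [stdTriple_apply])
    (fun y hy ⟨k, hk⟩ => by
      obtain ⟨m, hm⟩ := hsum y hy
      have hk' : y (j + 1) = k := hk
      refine mem_intLattice.2 (forall_fin_three_cyclic (j := j) hy.2 ⟨k, hk'⟩ ⟨m - k, ?_⟩)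
      push_cast
      linarith)
  have hyp' : y (j + 1) = 1 / p := hyp
  obtain ⟨a, ha⟩ := hy.2
  obtain ⟨b, hb⟩ := hsum y hy
  have ha' : y j = a := ha
  obtain ⟨hj1, hj2, hj3⟩ := cyclic_ne j
  refine ⟨p, ?_, ?_⟩
  · by_contra hlt
    obtain rfl : p = 1 := by omega
    apply hx0
    have hxM : x ∈ M := ⟨hx, hxj⟩
    have hyZ : y ∈ intLattice :=
      mem_intLattice.2 (forall_fin_three_cyclic (j := j) ⟨a, ha'⟩ ⟨1, by rw [hyp']; simp⟩
        ⟨b - 1, by rw [hyp'] at hb; push_cast at hb ⊢; linarith⟩)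
    obtain ⟨k, hk⟩ := mem_closure_subgroup_union.1 (hMy ▸ hxM)
    have := intLattice.add_mem hk (int_smul_mem hyZ k)
    rwa [sub_add_cancel] at this
  · have e : (1 / p : ℝ) • (stdTriple (j + 1) - stdTriple (j + 2)) =
        y - ((a : ℝ) • stdTriple j + (b : ℝ) • stdTriple (j + 2)) := by
      funext k
      simp only [Pi.smul_apply, Pi.sub_apply, Pi.add_apply, stdTriple_apply, smul_eq_mul]
      revert k
      refine forall_fin_three_cyclic (j := j) ?_ ?_ ?_
      · simp [hj1, hj2, ha']
      · simp [hj1.symm, hj3, hyp']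
      · simp only [hj2.symm, hj3.symm, if_true, if_false]
        rw [hyp'] at hb
        linarith
    rw [e]
    exact N.sub_mem hy.1 (hZ (intLattice.add_mem (int_smul_mem (stdTriple_mem_intLattice _) _)
      (int_smul_mem (stdTriple_mem_intLattice _) _)))

/-- Adjacent edges are divided into coprime numbers of parts, as the elements of order `l` of a
cyclic group form a cyclic group. -/
lemma coprime_edges {N : AddSubgroup V} (hN : IsCyclicLattice N) {j : Fin 3} {p q : ℕ}
    (hp0 : 0 < p) (hq0 : 0 < q)
    (hp : (1 / p : ℝ) • (stdTriple (j + 1) - stdTriple (j + 2)) ∈ N)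
    (hq : (1 / q : ℝ) • (stdTriple (j + 2) - stdTriple j) ∈ N) : Nat.Coprime p q := by
  by_contra hcop
  obtain ⟨l, hl, hlp, hlq⟩ := Nat.Prime.not_coprime_iff_dvd.1 hcop
  have hl0 : (l : ℝ) ≠ 0 := by exact_mod_cast hl.ne_zero
  have hdiv : ∀ {p : ℕ} {x : V}, 0 < p → l ∣ p → (1 / p : ℝ) • x ∈ N → (1 / l : ℝ) • x ∈ N := by
    rintro p x hp0 ⟨d, rfl⟩ hx
    have hd : (d : ℝ) ≠ 0 := by
      have := Nat.pos_of_mul_pos_left hp0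
      positivity
    have := nat_smul_mem hx d
    rw [smul_smul] at this
    convert this using 2
    push_cast
    field_simp
  replace hp := hdiv hp0 hlp hp
  replace hq := hdiv hq0 hlq hq
  obtain ⟨w, n, hn, hw, hNw⟩ := hN
  obtain ⟨a, ha⟩ := mem_closure_subgroup_union.1 (hNw ▸ hp)
  obtain ⟨b, hb⟩ := mem_closure_subgroup_union.1 (hNw ▸ hq)
  obtain ⟨hj1, hj2, hj3⟩ := cyclic_ne j
  -- the integers `k` with `k w ∈ ℤ³` form the ideal generated by `R`
  let A : AddSubgroup ℤ :=
    { carrier := {k | (k : ℝ) • w ∈ intLattice}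
      zero_mem' := by simp [intLattice.zero_mem]
      add_mem' := fun {a b} ha hb => by
        change ((a + b : ℤ) : ℝ) • w ∈ intLattice
        rw [Int.cast_add, add_smul]; exact intLattice.add_mem ha hb
      neg_mem' := fun {a} ha => by
        change ((-a : ℤ) : ℝ) • w ∈ intLattice
        rw [Int.cast_neg, neg_smul]; exact intLattice.neg_mem ha }
  have hA : ∀ k, k ∈ A ↔ (k : ℝ) • w ∈ intLattice := fun k => Iff.rfl
  obtain ⟨R, hR⟩ := Int.subgroup_cyclic A
  have hAR : ∀ k, k ∈ A ↔ R ∣ k := fun k => by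
    rw [hR, AddSubgroup.mem_closure_singleton]
    simp only [smul_eq_mul, dvd_def, eq_comm, mul_comm]
  have hlift : ∀ (c : ℤ) (x : V), x ∈ intLattice → (1 / l : ℝ) • x - (c : ℝ) • w ∈ intLattice →
      R ∣ l * c := by
    intro c x hx hc
    rw [← hAR, hA]
    have := intLattice.sub_mem hx (nat_smul_mem hc l)
    rw [smul_sub, smul_smul, mul_one_div_cancel hl0, one_smul, sub_sub_cancel, smul_smul] at this
    simpa using this
  have hdZ : ∀ j k, stdTriple j - stdTriple k ∈ intLattice := fun j k =>
    intLattice.sub_mem (stdTriple_mem_intLattice j) (stdTriple_mem_intLattice k)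
  obtain ⟨s, hs⟩ := hlift a _ (hdZ _ _) ha
  obtain ⟨t, ht⟩ := hlift b _ (hdZ _ _) hb
  have hlz : (l : ℤ) ≠ 0 := by exact_mod_cast hl.ne_zero
  -- a relation between the two elements of order `l`
  have hrel : (t : ℝ) • ((1 / l : ℝ) • (stdTriple (j + 1) - stdTriple (j + 2))) -
      (s : ℝ) • ((1 / l : ℝ) • (stdTriple (j + 2) - stdTriple j)) ∈ intLattice := by
    have h1 := intLattice.sub_mem (int_smul_mem ha t) (int_smul_mem hb s)
    have h2 : (t : ℝ) * a = s * b := by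
      have : t * a = s * b := by
        apply mul_left_cancel₀ hlz
        calc (l : ℤ) * (t * a) = t * (l * a) := by ring
          _ = s * (l * b) := by rw [hs, ht]; ring
          _ = l * (s * b) := by ring
      exact_mod_cast this
    rwa [smul_sub (t : ℝ) _ ((a : ℝ) • w), smul_sub (s : ℝ) _ ((b : ℝ) • w), smul_smul (t : ℝ) a,
      smul_smul (s : ℝ) b, h2, sub_sub_sub_cancel_right] at h1
  have hls : (l : ℤ) ∣ s := by
    obtain ⟨e, he⟩ := hrel j
    simp only [Pi.smul_apply, Pi.sub_apply, stdTriple_apply, smul_eq_mul, hj1, hj2, if_true,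
      if_false] at he
    refine ⟨e, ?_⟩
    field_simp at he
    have : (s : ℝ) = l * e := by linarith
    exact_mod_cast this
  obtain ⟨s', rfl⟩ := hls
  have ha' : R ∣ a := ⟨s', mul_left_cancel₀ hlz (by rw [hs]; ring)⟩
  have hx : (1 / l : ℝ) • (stdTriple (j + 1) - stdTriple (j + 2)) ∈ intLattice := by
    have := intLattice.add_mem ha ((hA a).1 ((hAR a).2 ha'))
    rwa [sub_add_cancel] at this
  obtain ⟨e, he⟩ := hx (j + 1)
  simp only [Pi.smul_apply, Pi.sub_apply, stdTriple_apply, smul_eq_mul, hj3, if_true,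
    if_false] at he
  field_simp at he
  have : (1 : ℤ) = l * e := by
    have h : (1 : ℝ) = l * e := by linarith
    exact_mod_cast h
  have h1 : (l : ℤ) ∣ 1 := ⟨e, this⟩
  exact hl.one_lt.ne' (by exact_mod_cast Int.eq_one_of_dvd_one (by positivity) h1)

/-- If the edges are divided into `p`, `q` and `s` parts with `p ≥ 3`, `q s ≥ 6` and `q`, `s`
coprime, all ages are integral: the triangle of age `τ`, for `1/2 ≤ τ < 1`, contains a translate by
the age `0` lattice vectors of any vector of age `τ`. -/
lemma integral_age_of_edges {N : AddSubgroup V} (hZ : intLattice ≤ N) (hcan : IsCanonical N)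
    {j : Fin 3} {p q s : ℕ} (hp : 3 ≤ p) (hqs : 6 ≤ q * s) (hcop : Nat.Coprime q s)
    (hpN : (1 / p : ℝ) • (stdTriple (j + 1) - stdTriple (j + 2)) ∈ N)
    (hqN : (1 / q : ℝ) • (stdTriple (j + 2) - stdTriple j) ∈ N)
    (hsN : (1 / s : ℝ) • (stdTriple j - stdTriple (j + 1)) ∈ N) {x : V} (hx : x ∈ N) :
    ∃ n : ℤ, age x = n := by
  obtain ⟨hj1, hj2, hj3⟩ := cyclic_ne j
  have main : ∀ x ∈ N, 1 / 2 ≤ Int.fract (age x) → False := by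
    intro x hx hage
    have hq0 : (q : ℝ) ≠ 0 := by
      rintro h; rw [Nat.cast_eq_zero] at h; subst h; omega
    have hs0 : (s : ℝ) ≠ 0 := by
      rintro h; rw [Nat.cast_eq_zero] at h; subst h; omega
    obtain ⟨α, β, hαβ⟩ := Nat.isCoprime_iff_coprime.2 hcop
    have hαβ' : (α : ℝ) * q + β * s = 1 := by exact_mod_cast hαβ
    have hqs' : (6 : ℝ) ≤ (q : ℝ) * s := by exact_mod_cast hqs
    have hp' : (3 : ℝ) ≤ p := by exact_mod_cast hp
    -- `y` has age `0` and `j`-th coordinate `1 / (q s)`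
    set y : V := (α : ℝ) • ((1 / s : ℝ) • (stdTriple j - stdTriple (j + 1))) -
      (β : ℝ) • ((1 / q : ℝ) • (stdTriple (j + 2) - stdTriple j)) with hy
    set u : V := (1 / p : ℝ) • (stdTriple (j + 1) - stdTriple (j + 2)) with hu
    have hyN : y ∈ N := N.sub_mem (int_smul_mem hsN α) (int_smul_mem hqN β)
    have hyj : y j = 1 / (q * s) := by
      simp only [hy, Pi.smul_apply, Pi.sub_apply, stdTriple_apply, smul_eq_mul, hj1, hj2, if_true,
        if_false]
      field_simp
      linarith
    have hstd : ∀ k, ageHom (stdTriple k) = 1 := fun k => by rw [ageHom_apply, age_stdTriple]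
    have hyage : ageHom y = 0 := by
      simp only [hy, map_sub, map_smul, hstd, sub_self, smul_zero]
    have huage : ageHom u = 0 := by
      simp only [hu, map_sub, map_smul, hstd, sub_self, smul_zero]
    have huj : u j = 0 := by
      simp [hu, stdTriple_apply, hj1, hj2]
    have huj1 : u (j + 1) = 1 / p := by
      simp [hu, stdTriple_apply, hj3]
    set z₀ : V := x - (⌊age x⌋ : ℝ) • stdTriple j with hz₀
    have hz₀N : z₀ ∈ N := N.sub_mem hx (int_smul_mem (hZ (stdTriple_mem_intLattice j)) _)
    have hz₀age : ageHom z₀ = Int.fract (age x) := by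
      rw [hz₀, map_sub, map_smul, hstd, ageHom_apply, smul_eq_mul, mul_one, Int.self_sub_floor]
    set z₁ : V := z₀ - (⌊z₀ j * (q * s)⌋ : ℝ) • y with hz₁
    have hz₁N : z₁ ∈ N := N.sub_mem hz₀N (int_smul_mem hyN _)
    have hz₁j : z₁ j = Int.fract (z₀ j * (q * s)) / (q * s) := by
      rw [hz₁, Pi.sub_apply, Pi.smul_apply, hyj, smul_eq_mul, Int.fract]
      field_simp
    set z₂ : V := z₁ - (⌊z₁ (j + 1) * p⌋ : ℝ) • u with hz₂
    have hz₂N : z₂ ∈ N := N.sub_mem hz₁N (int_smul_mem hpN _)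
    have hz₂j : z₂ j = z₁ j := by
      rw [hz₂, Pi.sub_apply, Pi.smul_apply, huj, smul_zero, sub_zero]
    have hp0 : (p : ℝ) ≠ 0 := by positivity
    have hz₂j1 : z₂ (j + 1) = Int.fract (z₁ (j + 1) * p) / p := by
      rw [hz₂, Pi.sub_apply, Pi.smul_apply, huj1, smul_eq_mul, Int.fract]
      field_simp
    have hz₂age : ageHom z₂ = Int.fract (age x) := by
      rw [hz₂, hz₁, map_sub, map_sub, map_smul, map_smul, hyage, huage, hz₀age]
      simp
    have b1 : z₂ j ≤ 1 / 6 := by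
      rw [hz₂j, hz₁j, div_le_iff₀ (by linarith)]
      have := Int.fract_lt_one (z₀ j * (q * s))
      linarith
    have b2 : z₂ (j + 1) ≤ 1 / 3 := by
      rw [hz₂j1, div_le_iff₀ (by linarith)]
      have := Int.fract_lt_one (z₁ (j + 1) * p)
      linarith
    have hsum := hz₂age
    rw [ageHom_apply, age, sum_fin_three_cyclic _ j] at hsum
    have hmem : z₂ ∈ orthant := by
      change ∀ k, 0 ≤ z₂ k
      refine forall_fin_three_cyclic (j := j) ?_ ?_ ?_
      · rw [hz₂j, hz₁j]
        exact div_nonneg (Int.fract_nonneg _) (by linarith)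
      · rw [hz₂j1]
        exact div_nonneg (Int.fract_nonneg _) (by linarith)
      · linarith
    have hne : z₂ ≠ 0 := by
      intro h
      rw [h, map_zero] at hz₂age
      linarith
    have h1 := hcan z₂ hz₂N hmem hne
    rw [← ageHom_apply, hz₂age] at h1
    linarith [Int.fract_lt_one (age x)]
  by_contra hnot
  have h0 : Int.fract (age x) ≠ 0 := fun h => hnot ⟨⌊age x⌋, by
    rw [← Int.floor_add_fract (age x), h, add_zero, Int.floor_intCast]⟩
  have h1 := main x hx
  have h2 := main (-x) (N.neg_mem hx)
  rw [← ageHom_apply, map_neg, ageHom_apply, Int.fract_neg h0] at h2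
  by_cases h : 1 / 2 ≤ Int.fract (age x)
  · exact h1 h
  · exact h2 (by linarith)

/-- In a canonical cyclic lattice with a nonintegral age, some coordinate is faithful modulo `ℤ³`;
otherwise all three edges of the triangle of age `1` are divided into pairwise coprime numbers of
parts. -/
theorem exists_faithful_coordinate {N : AddSubgroup V} (hN : IsCyclicLattice N)
    (hcan : IsCanonical N) (hnon : ¬ ∀ x ∈ N, ∃ n : ℤ, age x = n) :
    ∃ j : Fin 3, ∀ x ∈ N, (∃ n : ℤ, x j = n) → x ∈ intLattice := by
  by_contra! hcon
  choose x hx hxj hx0 using hcon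
  have hedge := fun j => exists_edge hN hcan (hx j) (hxj j) (hx0 j)
  choose p hp hpN using hedge
  have hpN1 : ∀ j, (1 / p (j + 1) : ℝ) • (stdTriple (j + 2) - stdTriple j) ∈ N := fun j => by
    obtain ⟨h1, h2, -⟩ := cyclic_add j
    have := hpN (j + 1)
    rwa [h1, h2] at this
  have hpN2 : ∀ j, (1 / p (j + 2) : ℝ) • (stdTriple j - stdTriple (j + 1)) ∈ N := fun j => by
    obtain ⟨-, -, h1, h2⟩ := cyclic_add j
    have := hpN (j + 2)
    rwa [h1, h2] at this
  have hcop : ∀ j, Nat.Coprime (p j) (p (j + 1)) := fun j =>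
    coprime_edges hN (by linarith [hp j]) (by linarith [hp (j + 1)]) (hpN j) (hpN1 j)
  have hsix : ∀ j, 6 ≤ p j * p (j + 1) := by
    intro j
    have h1 := hp j
    have h2 := hp (j + 1)
    have h3 : p j ≠ 2 ∨ p (j + 1) ≠ 2 := by
      by_contra! h
      have := hcop j
      rw [h.1, h.2] at this
      norm_num at this
    rcases h3 with h3 | h3
    · exact Nat.mul_le_mul (show 3 ≤ p j by omega) h2
    · exact Nat.mul_le_mul h1 (show 3 ≤ p (j + 1) by omega)
  obtain ⟨j, hj⟩ : ∃ j, 3 ≤ p j := by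
    by_contra! h
    have := hcop 0
    rw [show p 0 = 2 by have := hp 0; have := h 0; omega,
      show p (0 + 1) = 2 by have := hp (0 + 1); have := h (0 + 1); omega] at this
    norm_num at this
  have e := (cyclic_add j).1
  exact hnon fun x hx => integral_age_of_edges hN.intLattice_le hcan hj
    (by have := hsix (j + 1); rwa [e] at this) (by have := hcop (j + 1); rwa [e] at this)
    (hpN j) (hpN1 j) (hpN2 j) hx

/-! ### Resolutions of canonical cyclic lattices -/

/-- A cyclic lattice with integral ages and a faithful coordinate has a crepant Fujiki–Oka
resolution. -/
lemma exists_crepant {M : AddSubgroup V} (hM : IsCyclicLattice M)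
    (hint : ∀ x ∈ M, ∃ n : ℤ, age x = n) (j : Fin 3)
    (hf : ∀ x ∈ M, (∃ n : ℤ, x j = n) → x ∈ intLattice) :
    ∃ T, FujikiOka M j stdTriple T ∧ ∀ t ∈ T, ∀ k, t k ∈ M ∧ t k ∈ orthant ∧ age (t k) = 1 := by
  obtain ⟨r, hr⟩ := exists_isSemiUnimodular hM le_rfl hM.intLattice_le linearIndependent_stdTriple
    intLattice_eq_closure j (fun x hx ⟨k, hk⟩ => hf x hx ⟨k, by
      rw [← hk]
      conv_lhs => rw [← sum_coord_smul stdTriple linearIndependent_stdTriple x]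
      simp [-Module.Basis.coord_apply, Finset.sum_apply, stdTriple_apply]⟩)
  exact exists_fujikiOka_of_integral hint (fun k =>
    ⟨hM.intLattice_le (stdTriple_mem_intLattice k), stdTriple_mem_orthant k, age_stdTriple k⟩) hr

/-- A basis of age `1` vectors of the lattice of the vectors of integral ages with integral `0`-th
coordinate contains the standard basis vector `e₀`, and the other elements lie on the edge opposite
to it. -/
lemma exists_vertex {M : AddSubgroup V} {t : Fin 3 → V} (ht : LinearIndependent ℝ t)
    (hM : M = AddSubgroup.closure (Set.range t)) (hZ : intLattice ≤ M)
    (hM0 : ∀ x ∈ M, ∃ n : ℤ, x 0 = n)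
    (htM : ∀ k, t k ∈ M ∧ t k ∈ orthant ∧ age (t k) = 1) :
    ∃ k, ∀ x, (tripleBasis t ht).coord k x = x 0 := by
  have hsum : ∀ k, t k 0 + t k 1 + t k 2 = 1 := fun k => by
    rw [← (htM k).2.2, age, Fin.sum_univ_three]
  have hnn : ∀ k l, 0 ≤ t k l := fun k l => (htM k).2.1 l
  have h01 : ∀ k, t k 0 = 0 ∨ t k 0 = 1 := by
    intro k
    obtain ⟨n, hn⟩ := hM0 _ (htM k).1
    have h1 : t k 0 ≤ 1 := by linarith [hsum k, hnn k 1, hnn k 2]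
    have h0 := hnn k 0
    rw [hn] at h0 h1 ⊢
    have h0' : 0 ≤ n := by exact_mod_cast h0
    have h1' : n ≤ 1 := by exact_mod_cast h1
    rcases (by omega : n = 0 ∨ n = 1) with rfl | rfl
    · left; norm_num
    · right; norm_num
  have hone : ∀ k, t k 0 = 1 → t k = stdTriple 0 := by
    intro k hk
    have h1 : t k 1 = 0 := by linarith [hsum k, hnn k 1, hnn k 2]
    have h2 : t k 2 = 0 := by linarith [hsum k, hnn k 1, hnn k 2]
    funext l
    fin_cases l
    · simpa [stdTriple_apply] using hk
    · simpa [stdTriple_apply] using h1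
    · simpa [stdTriple_apply] using h2
  have hex : ∃ k, t k 0 = 1 := by
    by_contra! hcon
    obtain ⟨n, hn⟩ := mem_closure_range.1 (hM ▸ hZ (stdTriple_mem_intLattice 0))
    have := congrFun hn 0
    rw [Finset.sum_apply, Finset.sum_eq_zero fun k _ => by
      rw [Pi.smul_apply, (h01 k).resolve_right (hcon k), smul_zero]] at this
    simp [stdTriple_apply] at this
  obtain ⟨k, hk⟩ := hex
  refine ⟨k, fun x => ?_⟩
  have := congrFun (sum_coord_smul t ht x) 0
  rw [← this, Finset.sum_apply, Finset.sum_eq_single k]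
  · rw [Pi.smul_apply, hk, smul_eq_mul, mul_one]
  · intro l _ hl
    rw [Pi.smul_apply, (h01 l).resolve_right fun h => hl (ht.injective ?_), smul_zero]
    rw [hone l h, hone k hk]
  · simp

lemma IsCyclicLattice.intLattice_le_integralPart_age {N : AddSubgroup V}
    (hN : IsCyclicLattice N) : intLattice ≤ integralPart N ageHom := by
  intro x hx
  choose n hn using hx
  refine ⟨hN.intLattice_le fun j => ⟨n j, hn j⟩, ∑ j, n j, ?_⟩
  rw [ageHom_apply, age]
  push_cast
  simp only [hn]

/-- If all ages are integral, subdivide the edge opposite to `e₀` by its lattice points. The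
resulting cones are semi-unimodular over `e₀`. -/
lemma exists_two_step_of_integral {N : AddSubgroup V} (hN : IsCyclicLattice N)
    (hcan : IsCanonical N) (hint : ∀ x ∈ N, ∃ n : ℤ, age x = n) :
    ∃ M, intLattice ≤ M ∧ M ≤ N ∧ ∃ i T₁, FujikiOka M i stdTriple T₁ ∧
      (∀ t ∈ T₁, ∀ j, t j ∈ M ∧ t j ∈ orthant ∧ age (t j) = 1) ∧
      ∀ t ∈ T₁, ∃ i T, FujikiOka N i t T ∧ ∀ t' ∈ T, ∀ j, t' j ∈ hilbertBasis N orthant := by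
  have hZ := hN.intLattice_le
  set M := integralPart N (LinearMap.proj 0) with hM
  have hZM : intLattice ≤ M := fun x hx => ⟨hZ hx, hx 0⟩
  have hMN : M ≤ N := integralPart_le _ _
  have hMcan : IsCanonical M := fun x hx => hcan x (hMN hx)
  obtain ⟨T₁, hT₁, hage⟩ := exists_crepant (hN.of_le hZM hMN) (fun x hx => hint x hx.1) 1
    (fun x hx ⟨k, hk⟩ => by
      obtain ⟨n, hn⟩ := hint x hx.1
      obtain ⟨m, hm⟩ := hx.2
      have hm' : x 0 = m := hm
      rw [age, Fin.sum_univ_three] at hn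
      intro l
      fin_cases l
      · exact ⟨m, hm'⟩
      · exact ⟨k, hk⟩
      · refine ⟨n - m - k, ?_⟩
        push_cast
        linarith)
  refine ⟨M, hZM, hMN, 1, T₁, hT₁, hage, fun t ht => ?_⟩
  have hH := (hT₁.triangulation linearIndependent_stdTriple fun t ht j =>
    mem_hilbertBasis_of_age_eq_one hMcan (hage t ht j).1 (hage t ht j).2.1
      (hage t ht j).2.2).2.1 t ht
  obtain ⟨k, hk⟩ := exists_vertex hH.linInd hH.closure hZM (fun x hx => hx.2) (hage t ht)
  obtain ⟨r, hr⟩ := exists_isSemiUnimodular hN hZM hMN hH.linInd hH.closure k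
    (fun x hx ⟨n, hn⟩ => ⟨hx, n, by rw [← hn, hk]; rfl⟩)
  obtain ⟨T, hT, hTage⟩ := exists_fujikiOka_of_integral hint
    (fun j => ⟨hMN (hage t ht j).1, (hage t ht j).2⟩) hr
  exact ⟨k, T, hT, fun t' ht' j => mem_hilbertBasis_of_age_eq_one hcan (hTage t' ht' j).1
    (hTage t' ht' j).2.1 (hTage t' ht' j).2.2⟩

lemma mod_add_mod_le {m x y : ℕ} (hm : 0 < m) (h : m ∣ x + y) : x % m + y % m ≤ m := by
  have h1 : m ∣ x % m + y % m := by
    rwa [Nat.dvd_iff_mod_eq_zero, Nat.add_mod, Nat.mod_mod, Nat.mod_mod, ← Nat.add_mod,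
      ← Nat.dvd_iff_mod_eq_zero]
  obtain ⟨c, hc⟩ := h1
  have h2 := Nat.mod_lt x hm
  have h3 := Nat.mod_lt y hm
  have h4 : m * c < m * 2 := by omega
  have h5 : c < 2 := lt_of_mul_lt_mul_left h4 (Nat.zero_le m)
  have h6 : m * c ≤ m * 1 := Nat.mul_le_mul_left m (by omega)
  omega

/-- Let `t` be a basis of age `1` vectors of the sublattice of integral ages, of index `m ≥ 2`. The
lattice points of the half-open box spanned by `t` have the ages `1 + k/m` with `0 < k < m`: for
opposite points, both of age more than `1`, these add up to at most `3`. By the terminal lemma, `t`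
is a terminal cone. -/
lemma exists_fujikiOka_of_nonintegral {N M : AddSubgroup V} (hN : IsCyclicLattice N)
    (hcan : IsCanonical N) (hM : M = integralPart N ageHom)
    (hnon : ¬ ∀ x ∈ N, ∃ n : ℤ, age x = n) {t : Fin 3 → V} (ht : LinearIndependent ℝ t)
    (hMt : M = AddSubgroup.closure (Set.range t))
    (htM : ∀ k, t k ∈ M ∧ t k ∈ orthant ∧ age (t k) = 1) :
    ∃ i T, FujikiOka N i t T ∧ ∀ t' ∈ T, ∀ j, t' j ∈ hilbertBasis N orthant := by
  have hMN : M ≤ N := hM ▸ integralPart_le _ _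
  have hZM : intLattice ≤ M := hM ▸ hN.intLattice_le_integralPart_age
  obtain ⟨w, n, hn, hw, hNw⟩ := hN.over hZM hMN
  obtain ⟨m, hm, x, hx, hagex, hmx, hNx⟩ := exists_generator hn hNw hw ageHom
    (fun x hx => by rw [hM] at hx; exact hx.2) (htM 0).1 (by rw [ageHom_apply, (htM 0).2.2])
    (fun x hx hk => by rw [hM]; exact ⟨hx, hk⟩)
  have hm0 : (0 : ℝ) < m := by positivity
  have hm1 : 1 < m := by
    by_contra hlt
    obtain rfl : m = 1 := by omega
    rw [Nat.cast_one, one_smul] at hmx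
    refine hnon fun y hy => ?_
    obtain ⟨k, hk⟩ := mem_closure_subgroup_union.1 (hNx ▸ hy)
    have := M.add_mem hk (int_smul_mem hmx k)
    rw [sub_add_cancel, hM] at this
    obtain ⟨-, n, hn⟩ := this
    exact ⟨n, by rw [← hn, ageHom_apply]⟩
  -- move the generator into the box spanned by `t`
  obtain ⟨A, hA⟩ := mem_closure_range.1 (hMt ▸ hmx)
  have hxA : ∑ k, ((A k : ℝ) / m) • t k = x := by
    have : ∑ k, ((A k : ℝ) / m) • t k = (m : ℝ)⁻¹ • ∑ k, (A k : ℝ) • t k := by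
      rw [Finset.smul_sum]
      refine Finset.sum_congr rfl fun k _ => ?_
      rw [smul_smul, div_eq_inv_mul]
    rw [this, hA, smul_smul, inv_mul_cancel₀ hm0.ne', one_smul]
  obtain ⟨a, ha, ham⟩ := exists_nat_emod hm A
  have hxc := sum_eq_okaCenter_add (v := t) hm ha
  rw [hxA] at hxc
  set c := okaCenter t m a with hc
  have hdiff : ∑ j, ((A j / m : ℤ) : ℝ) • t j ∈ M := sum_int_smul_mem (fun j => (htM j).1) _
  have hNc : N = AddSubgroup.closure (Set.range t ∪ {c}) := by
    rw [hNx]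
    refine closure_union_singleton_congr (fun s hs => ?_) ?_ ?_ ?_
    · rw [SetLike.mem_coe, hMt] at hs
      exact AddSubgroup.closure_mono Set.subset_union_left hs
    · rw [hxc]
      exact AddSubgroup.add_mem _ mem_closure_right
        (AddSubgroup.closure_mono Set.subset_union_left (hMt ▸ hdiff))
    · rintro _ ⟨k, rfl⟩
      exact mem_closure_left (htM k).1
    · rw [← sub_eq_iff_eq_add] at hxc
      rw [← hxc]
      exact AddSubgroup.sub_mem _ mem_closure_right (mem_closure_left hdiff)
  have hcN : c ∈ N := hNc ▸ mem_closure_right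
  have hageoka : ∀ b : Fin 3 → ℕ, ageHom (okaCenter t m b) = ((b 0 + b 1 + b 2 : ℕ) : ℝ) / m := by
    intro b
    rw [map_okaCenter, Fin.sum_univ_three]
    simp only [ageHom_apply, (htM _).2.2]
    push_cast
    ring
  obtain ⟨n₀, hn₀⟩ : ∃ n₀ : ℤ, ((a 0 + a 1 + a 2 : ℕ) : ℤ) = 1 + m * n₀ := by
    refine ⟨-∑ j, A j / m, ?_⟩
    have := congrArg ageHom hxc
    rw [map_add, hagex, hageoka, map_sum] at this
    simp only [map_smul, ageHom_apply, (htM _).2.2, smul_eq_mul, mul_one] at this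
    rw [← Int.cast_sum] at this
    field_simp at this
    have h : ((a 0 + a 1 + a 2 : ℕ) : ℝ) = 1 + m * ((-∑ j, A j / m : ℤ) : ℝ) := by
      push_cast at this ⊢
      linarith
    exact_mod_cast h
  -- the box point in the class of `k c`
  have hbox : ∀ k, 0 < k → k < m → m + k ≤ a 0 * k % m + a 1 * k % m + a 2 * k % m := by
    intro k hk0 hkm
    set b : Fin 3 → ℕ := fun j => a j * k % m with hb
    have hpN : okaCenter t m b ∈ N := by
      have h1 := sum_eq_okaCenter_add (v := t) (A := fun j => ((a j * k : ℕ) : ℤ)) (a := b) hm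
        (fun j => by simp [hb])
      have h2 : ∑ j, ((((a j * k : ℕ) : ℤ) : ℝ) / m) • t j = (k : ℝ) • c := by
        rw [hc, okaCenter, Finset.smul_sum]
        refine Finset.sum_congr rfl fun j _ => ?_
        rw [smul_smul]
        congr 1
        push_cast
        ring
      rw [h2, ← sub_eq_iff_eq_add] at h1
      rw [← h1]
      exact N.sub_mem (nat_smul_mem hcN k) (sum_int_smul_mem (fun j => hMN (htM j).1) _)
    have hage := hageoka b
    obtain ⟨e, he⟩ : ∃ e : ℤ, ((b 0 + b 1 + b 2 : ℕ) : ℤ) = k + m * e := by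
      refine ⟨n₀ * k - (a 0 * k / m : ℕ) - (a 1 * k / m : ℕ) - (a 2 * k / m : ℕ), ?_⟩
      have h : ∀ j, (b j : ℤ) = a j * k - m * (a j * k / m : ℕ) := fun j => by
        have := Nat.div_add_mod (a j * k) m
        have h' : (m : ℤ) * (a j * k / m : ℕ) + b j = a j * k := by exact_mod_cast this
        linarith
      push_cast at hn₀ h ⊢
      rw [h, h, h]
      linear_combination (k : ℤ) * hn₀
    have hsum0 : b 0 + b 1 + b 2 ≠ 0 := by
      intro h0
      rw [h0] at he
      have hdvd : (m : ℤ) ∣ k := ⟨-e, by push_cast at he; linarith⟩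
      have := Nat.le_of_dvd hk0 (by exact_mod_cast hdvd)
      omega
    have hne : okaCenter t m b ≠ 0 := by
      intro h0
      rw [h0, map_zero, eq_comm, div_eq_zero_iff] at hage
      rcases hage with h | h
      · exact hsum0 (by exact_mod_cast h)
      · exact hm0.ne' h
    have h1 := hcan _ hpN (okaCenter_mem_orthant (fun j => (htM j).2.1) m b) hne
    rw [← ageHom_apply, hage, le_div_iff₀ hm0, one_mul] at h1
    have h1' : m ≤ b 0 + b 1 + b 2 := by exact_mod_cast h1
    have he1 : 1 ≤ e := by
      by_contra! hlt
      have : (m : ℤ) * e ≤ m * 0 := mul_le_mul_of_nonneg_left (by omega) (by positivity)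
      have h1'' : (m : ℤ) ≤ ((b 0 + b 1 + b 2 : ℕ) : ℤ) := by exact_mod_cast h1'
      omega
    have : (m : ℤ) * 1 ≤ m * e := mul_le_mul_of_nonneg_left he1 (by positivity)
    change m + k ≤ b 0 + b 1 + b 2
    omega
  have hopp : ∀ k, k < m → ∀ j, a j * k % m + a j * (m - k) % m ≤ m := fun k hk j =>
    mod_add_mod_le hm ⟨a j, by rw [← Nat.mul_add, Nat.add_sub_cancel' hk.le, mul_comm]⟩
  have hres : ∀ k, 0 < k → k < m → a 0 * k % m + a 1 * k % m + a 2 * k % m = m + k ∧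
      ∀ j, a j * k % m + a j * (m - k) % m = m := by
    intro k hk0 hkm
    have h1 := hbox k hk0 hkm
    have h2 := hbox (m - k) (by omega) (by omega)
    have h3 := hopp k hkm 0
    have h4 := hopp k hkm 1
    have h5 := hopp k hkm 2
    refine ⟨by omega, fun j => ?_⟩
    fin_cases j
    · change a 0 * k % m + a 0 * (m - k) % m = m; omega
    · change a 1 * k % m + a 1 * (m - k) % m = m; omega
    · change a 2 * k % m + a 2 * (m - k) % m = m; omega
  have hapos : ∀ j, 0 < a j := by
    intro j
    have := (hres 1 one_pos hm1).2 j
    have h2 := Nat.mod_lt (a j * (m - 1)) hm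
    by_contra! h0
    have h0' : a j = 0 := by omega
    rw [h0'] at this h2
    simp at this
    omega
  obtain ⟨i, hi⟩ := eq_one_of_residues hm1 (fun j => ⟨hapos j, ham j⟩)
    fun k hk0 hkm => (hres k hk0 hkm).1
  have hasum : a 0 + a 1 + a 2 = m + 1 := by
    have := (hres 1 one_pos hm1).1
    simpa [Nat.mod_eq_of_lt (ham _)] using this
  have hint : ∀ y ∈ N, ∃ n : ℤ, age y - (tripleBasis t ht).coord i y = n := by
    intro y hy
    obtain ⟨b, e, rfl⟩ := mem_closure_range_union.1 (hNc ▸ hy)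
    refine ⟨∑ j, b j + e - b i, ?_⟩
    rw [← ageHom_apply, map_add, map_add, coord_sum t ht (fun j => (b j : ℝ)), map_smul, map_smul,
      hageoka, hc, coord_okaCenter, hi, hasum, map_sum]
    simp only [map_smul, ageHom_apply, (htM _).2.2, smul_eq_mul, mul_one]
    push_cast
    field_simp
    ring
  exact ⟨i, exists_fujikiOka_of_terminal hcan ht (fun j => ⟨hMN (htM j).1, (htM j).2⟩) hint
    ⟨hm, fun j => a j, by simp [hi], by simpa [hc, okaCenter] using hNc⟩⟩

/-- If some age is not integral, the first resolution is that of the sublattice of integral ages;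
its cones are terminal. -/
lemma exists_two_step_of_nonintegral {N : AddSubgroup V} (hN : IsCyclicLattice N)
    (hcan : IsCanonical N) (hnon : ¬ ∀ x ∈ N, ∃ n : ℤ, age x = n) :
    ∃ M, intLattice ≤ M ∧ M ≤ N ∧ ∃ i T₁, FujikiOka M i stdTriple T₁ ∧
      (∀ t ∈ T₁, ∀ j, t j ∈ M ∧ t j ∈ orthant ∧ age (t j) = 1) ∧
      ∀ t ∈ T₁, ∃ i T, FujikiOka N i t T ∧ ∀ t' ∈ T, ∀ j, t' j ∈ hilbertBasis N orthant := by
  obtain ⟨j, hj⟩ := exists_faithful_coordinate hN hcan hnon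
  set M := integralPart N ageHom with hM
  have hMN : M ≤ N := integralPart_le _ _
  have hZM : intLattice ≤ M := hN.intLattice_le_integralPart_age
  have hMcan : IsCanonical M := fun x hx => hcan x (hMN hx)
  obtain ⟨T₁, hT₁, hage⟩ := exists_crepant (hN.of_le hZM hMN)
    (fun x ⟨_, n, hn⟩ => ⟨n, by rw [← hn, ageHom_apply]⟩) j (fun x hx => hj x hx.1)
  refine ⟨M, hZM, hMN, j, T₁, hT₁, hage, fun t ht => ?_⟩
  have hH := (hT₁.triangulation linearIndependent_stdTriple fun t ht j =>
    mem_hilbertBasis_of_age_eq_one hMcan (hage t ht j).1 (hage t ht j).2.1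
      (hage t ht j).2.2).2.1 t ht
  exact exists_fujikiOka_of_nonintegral hN hcan hM hnon hH.linInd hH.closure (hage t ht)

/-! ### The lattice of a cyclic diagonal group -/

/-- The homomorphism `v ↦ diag(exp(2πi v₁), exp(2πi v₂), exp(2πi v₃))`. -/
noncomputable def diagExpHom : Multiplicative V →* Matrix (Fin 3) (Fin 3) ℂ where
  toFun v := Matrix.diagonal fun i => Complex.exp (2 * Real.pi * Complex.I * (v.toAdd i : ℂ))
  map_one' := by simp
  map_mul' v w := by
    rw [Matrix.diagonal_mul_diagonal]
    congr 1
    funext i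
    rw [← Complex.exp_add, toAdd_mul, Pi.add_apply, Complex.ofReal_add, mul_add]

/-- The homomorphism `v ↦ P⁻¹ diag(exp(2πi v₁), exp(2πi v₂), exp(2πi v₃)) P`. -/
noncomputable def expHom (P : GL (Fin 3) ℂ) : Multiplicative V →* GL (Fin 3) ℂ :=
  (MulAut.conj P⁻¹).toMonoidHom.comp diagExpHom.toHomUnits

lemma conj_expHom (P : GL (Fin 3) ℂ) (x : V) :
    ((P * expHom P (.ofAdd x) * P⁻¹ : GL (Fin 3) ℂ) : Matrix (Fin 3) (Fin 3) ℂ) =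
      Matrix.diagonal fun i => Complex.exp (2 * Real.pi * Complex.I * (x i : ℂ)) := by
  have : P * expHom P (.ofAdd x) * P⁻¹ = diagExpHom.toHomUnits (.ofAdd x) := by
    simp only [expHom, MonoidHom.comp_apply, MulEquiv.coe_toMonoidHom, MulAut.conj_apply, inv_inv,
      mul_assoc, mul_inv_cancel_left, mul_inv_cancel, mul_one]
  rw [this]
  rfl

lemma expHom_eq_iff (P : GL (Fin 3) ℂ) (x : V) (g : GL (Fin 3) ℂ) :
    expHom P (.ofAdd x) = g ↔ ((P * g * P⁻¹ : GL (Fin 3) ℂ) : Matrix (Fin 3) (Fin 3) ℂ) =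
      Matrix.diagonal fun i => Complex.exp (2 * Real.pi * Complex.I * (x i : ℂ)) := by
  rw [← conj_expHom P x, Units.val_inj, mul_left_inj, mul_right_inj, eq_comm]

lemma mem_weightLattice {P : GL (Fin 3) ℂ} {G : Subgroup (GL (Fin 3) ℂ)} {x : V} :
    x ∈ weightLattice P G ↔ expHom P (.ofAdd x) ∈ G := by
  constructor
  · rintro ⟨g, hg, h⟩
    rwa [(expHom_eq_iff P x g).2 h]
  · intro h
    exact ⟨_, h, conj_expHom P x⟩

lemma expHom_eq_one_iff (P : GL (Fin 3) ℂ) (x : V) :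
    expHom P (.ofAdd x) = 1 ↔ x ∈ intLattice := by
  have hpi : (2 * Real.pi * Complex.I : ℂ) ≠ 0 := Complex.two_pi_I_ne_zero
  rw [expHom_eq_iff, mul_one, mul_inv_cancel, Units.val_one, ← Matrix.diagonal_one,
    Matrix.diagonal_eq_diagonal_iff, mem_intLattice]
  refine forall_congr' fun j => ?_
  rw [eq_comm, Complex.exp_eq_one_iff]
  refine exists_congr fun n => ?_
  rw [mul_comm, mul_left_inj' hpi]
  exact_mod_cast Iff.rfl

/-- Every element of finite order that is diagonal in the coordinates `P` comes from a vector. -/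
lemma exists_expHom_eq {P g : GL (Fin 3) ℂ}
    (hg : ((P * g * P⁻¹ : GL (Fin 3) ℂ) : Matrix (Fin 3) (Fin 3) ℂ).IsDiag)
    {n : ℕ} (hn : n ≠ 0) (hgn : g ^ n = 1) : ∃ x : V, expHom P (.ofAdd x) = g := by
  set D := ((P * g * P⁻¹ : GL (Fin 3) ℂ) : Matrix (Fin 3) (Fin 3) ℂ) with hD
  have hDd : Matrix.diagonal D.diag = D := hg.diagonal_diag
  have hDn : D ^ n = 1 := by
    rw [hD, ← Units.val_pow_eq_pow_val, conj_pow, hgn, mul_one, mul_inv_cancel, Units.val_one]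
  have hroot : ∀ j, D.diag j ^ n = 1 := by
    intro j
    rw [← hDd, Matrix.diagonal_pow, ← Matrix.diagonal_one, Matrix.diagonal_eq_diagonal_iff] at hDn
    simpa using hDn j
  have hnorm : ∀ j, ‖D.diag j‖ = 1 := fun j => Complex.norm_eq_one_of_pow_eq_one (hroot j) hn
  refine ⟨fun j => (D.diag j).arg / (2 * Real.pi), ?_⟩
  rw [expHom_eq_iff, ← hD]
  conv_lhs => rw [← hDd]
  rw [Matrix.diagonal_eq_diagonal_iff]
  intro j
  have hpi : (Real.pi : ℂ) ≠ 0 := by exact_mod_cast Real.pi_ne_zero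
  conv_lhs => rw [← Complex.norm_mul_exp_arg_mul_I (D.diag j), hnorm, Complex.ofReal_one, one_mul]
  congr 1
  push_cast
  field_simp

lemma isCyclicLattice_weightLattice (G : Subgroup (GL (Fin 3) ℂ)) [Finite G] [IsCyclic G]
    (P : GL (Fin 3) ℂ)
    (hP : ∀ g ∈ G, ((P * g * P⁻¹ : GL (Fin 3) ℂ) : Matrix (Fin 3) (Fin 3) ℂ).IsDiag) :
    IsCyclicLattice (weightLattice P G) := by
  obtain ⟨⟨g, hg⟩, hgen⟩ := IsCyclic.exists_generator (α := G)
  have hcard : g ^ Nat.card G = 1 :=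
    congrArg Subtype.val (pow_card_eq_one' (G := G) (x := ⟨g, hg⟩))
  obtain ⟨w, hw⟩ := exists_expHom_eq (hP g hg) Nat.card_pos.ne' hcard
  refine ⟨w, Nat.card G, Nat.card_pos, ?_, ?_⟩
  · rw [← expHom_eq_one_iff P, Nat.cast_smul_eq_nsmul, ofAdd_nsmul, map_pow, hw, hcard]
  · apply le_antisymm
    · intro x hx
      rw [mem_weightLattice] at hx
      obtain ⟨k, hk⟩ := Subgroup.mem_zpowers_iff.1 (hgen ⟨_, hx⟩)
      have hk' : g ^ k = expHom P (.ofAdd x) := congrArg Subtype.val hk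
      refine mem_closure_subgroup_union.2 ⟨k, ?_⟩
      rw [← expHom_eq_one_iff P, Int.cast_smul_eq_zsmul, ofAdd_sub, map_div, ofAdd_zsmul,
        map_zpow, hw, hk', div_self']
    · rw [AddSubgroup.closure_le]
      rintro s (hs | rfl)
      · rw [SetLike.mem_coe, mem_weightLattice, (expHom_eq_one_iff P s).2 hs]
        exact G.one_mem
      · rw [SetLike.mem_coe, mem_weightLattice, hw]
        exact hg

/-- Intermediate lattices correspond to subgroups. -/
lemma exists_subgroup_weightLattice {G : Subgroup (GL (Fin 3) ℂ)} {P : GL (Fin 3) ℂ}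
    {M : AddSubgroup V} (hZM : intLattice ≤ M) (hM : M ≤ weightLattice P G) :
    ∃ H ≤ G, weightLattice P H = M := by
  refine ⟨(AddSubgroup.toSubgroup M).map (expHom P), ?_, ?_⟩
  · rintro _ ⟨y, hy, rfl⟩
    exact mem_weightLattice.1 (hM hy)
  · ext x
    rw [mem_weightLattice]
    constructor
    · rintro ⟨y, hy, hxy⟩
      have hy' : y.toAdd ∈ M := hy
      have h1 : x - y.toAdd ∈ intLattice := by
        rw [← expHom_eq_one_iff P, ofAdd_sub, map_div, ← hxy, ofAdd_toAdd, div_self']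
      have := M.add_mem (hZM h1) hy'
      rwa [sub_add_cancel] at this
    · intro hx
      exact ⟨.ofAdd x, hx, rfl⟩

theorem theorem4p4 (G : Subgroup (GL (Fin 3) ℂ)) [Finite G] [IsCyclic G]
    (P : GL (Fin 3) ℂ)
    (hP : ∀ g ∈ G, ((P * g * P⁻¹ : GL (Fin 3) ℂ) : Matrix (Fin 3) (Fin 3) ℂ).IsDiag)
    (hcan : IsCanonical (weightLattice P G)) :
    ∃ Δ : Set (PointedCone ℝ V),
      IsIteratedFujikiOka P G Δ ∧
      IsHilbertDesingularization (weightLattice P G) orthant Δ := by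
  have hN := isCyclicLattice_weightLattice G P hP
  obtain ⟨M, hZM, hMN, i, T₁, hT₁, hage, hT₂⟩ : ∃ M, intLattice ≤ M ∧ M ≤ weightLattice P G ∧
      ∃ i T₁, FujikiOka M i stdTriple T₁ ∧
      (∀ t ∈ T₁, ∀ j, t j ∈ M ∧ t j ∈ orthant ∧ age (t j) = 1) ∧
      ∀ t ∈ T₁, ∃ i T, FujikiOka (weightLattice P G) i t T ∧
        ∀ t' ∈ T, ∀ j, t' j ∈ hilbertBasis (weightLattice P G) orthant := by
    by_cases hint : ∀ x ∈ weightLattice P G, ∃ n : ℤ, age x = n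
    · exact exists_two_step_of_integral hN hcan hint
    · exact exists_two_step_of_nonintegral hN hcan hint
  obtain ⟨H, hHG, rfl⟩ := exists_subgroup_weightLattice hZM hMN
  obtain ⟨hres, T₂, hres₂, hΔ⟩ := exists_iterated hMN hcan
    (fun j => hZM (stdTriple_mem_intLattice j)) hT₁ hage hT₂
  exact ⟨_, ⟨H, hHG, T₁, hres, T₂, hres₂, rfl, hΔ.1⟩, hΔ⟩
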